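/- A K-loop $(B,+,0)$ is a set with a binary operation such that $0+a=a+0=a$ for all $a$, the equations $x+a=b$ and $a+y=b$ each have a unique solution for all $a,b\in B$, and, writing $-a$ for the inverse of $a$, one has $a+(b+(a+c))=(a+(b+a))+c$ and $-(a+b)=(-a)+(-b)$ for all $a,b,c\in B$. It is uniquely 2-divisible if $x\mapsto x+x$ is a bijection of $B$. A subloop is a subset that contains $0$, is closed under $+$, and in which the equations $x+a=b$, $a+y=b$ (for $a,b$ in the subset) are solvable. Put $s(x,y)=y+(-x+y)$; $B$ is a symétron for this operation, and a definable sub-symétron is a definable subset $Y$ that is convex, i.e. $s(x,y)\in Y$ for all $x,y\in Y$. Let $B$ be a first-order structure, $\omega$-stable (in every model of its complete theory there are only countably many complete $1$-types over each countable set of parameters), with a definable operation making it a uniquely 2-divisible K-loop. Here "definable" means first-order definable with parameters, and Morley rank and Morley degree are taken in the sense of the theory of $B$ (i.e. computed in elementary extensions). Proposition. The following conditions are equivalent: 1. $B$ is b-connected: $B$ has no proper definable subloop of the same Morley rank as $B$; 2. $B$ is connected as a symétron: $B$ has no proper definable sub-symétron of the same Morley rank as $B$; 3. $B$ has Morley degree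 $1$. Moreover, in every such $B$ (connected or not) there is exactly one definable subloop $B^{\circ}$ of the same Morley rank as $B$ that is connected, i.e. that contains no proper definable sub-symétron of the same Morley rank as itself. It is called the connected component of $B$. -/

import Mathlib

open scoped FirstOrder

universe u v w

/-- A K-loop `(B, +, 0)`: a loop satisfying the (left) Bol identity and the automorphic inverse
property. The element `-a` is the solution `y` of `a + y = 0`, which is unique in a loop
(by the Bol identity it is also the solution of `y + a = 0`). -/
class KLoop (B : Type w) extends Zero B, Add B, Neg B where
  zero_add' : ∀ a : B, 0 + a = a
  add_zero' : ∀ a : B, a + 0 = a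
  existsUnique_left : ∀ a b : B, ∃! x : B, x + a = b
  existsUnique_right : ∀ a b : B, ∃! y : B, a + y = b
  add_neg' : ∀ a : B, a + -a = 0
  bol : ∀ a b c : B, a + (b + (a + c)) = (a + (b + a)) + c
  neg_add' : ∀ a b : B, -(a + b) = -a + -b

namespace KLoop

/-- `B` is uniquely 2-divisible: `x ↦ x + x` is a bijection. -/
def UniquelyTwoDivisible (B : Type w) [KLoop B] : Prop :=
  Function.Bijective fun x : B => x + x

/-- The symétron operation of a K-loop: the image `s_y(x) = y + (-x + y)` of `x` under the
symmetry with centre `y`. -/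
def symm {B : Type w} [KLoop B] (x y : B) : B := y + (-x + y)

/-- A subloop: a subset that contains `0`, is closed under addition, and in which the equations
`x + a = b` and `a + y = b` can be solved. -/
structure IsSubloop {B : Type w} [KLoop B] (C : Set B) : Prop where
  zero_mem : (0 : B) ∈ C
  add_mem : ∀ a ∈ C, ∀ b ∈ C, a + b ∈ C
  exists_left : ∀ a ∈ C, ∀ b ∈ C, ∃ x ∈ C, x + a = b
  exists_right : ∀ a ∈ C, ∀ b ∈ C, ∃ y ∈ C, a + y = b

/-- A convex subset: `s_y(x)` lies in `Y` for all `x, y` in `Y`. The definable sub-symétrons are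
the definable convex subsets. -/
def IsConvexSubset {B : Type w} [KLoop B] (Y : Set B) : Prop :=
  ∀ x ∈ Y, ∀ y ∈ Y, symm x y ∈ Y

end KLoop

namespace ModelTheory

/-- The subset of `N` defined by a formula `φ(x)` in one variable with parameters in `N`. -/
def solutionSet {L : FirstOrder.Language.{u, v}} {N : Type w} [L.Structure N]
    (φ : L.Formula (N ⊕ Unit)) : Set N :=
  {x | φ.Realize (Sum.elim id fun _ => x)}

/-- Transport of a formula with parameters along an elementary embedding. -/
def transport {L : FirstOrder.Language.{u, v}} {N : Type*} {N' : Type*} [L.Structure N] [L.Structure N']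
    (j : N ↪ₑ[L] N') (φ : L.Formula (N ⊕ Unit)) : L.Formula (N' ⊕ Unit) :=
  φ.relabel (Sum.map j id)

/-- The structure `M` is ω-stable: in every model of its complete theory there are only countably
many complete `1`-types over each countable set of parameters. -/
def OmegaStable (L : FirstOrder.Language.{u, v}) (M : Type w) [L.Structure M] : Prop :=
  ∀ (N : Type (max u v w)) [L.Structure N], N ⊨ L.completeTheory M →
    ∀ A : Set N, A.Countable → Countable ((L[[A]].completeTheory N).CompleteType Unit)

/-- `RM(φ) ≥ α`, for a formula `φ(x)` with parameters in `N`. The solution set is non-empty and,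
for every `β < α`, some elementary extension of `N` contains infinitely many pairwise disjoint
subsets of the solution set of `φ`, defined by formulas (with parameters there) of rank `≥ β`.
All elementary extensions are allowed, which has the same effect as computing the rank in an
`ω`-saturated extension or in a monster model. -/
def FormulaRankGE (L : FirstOrder.Language.{u, v}) (α : Ordinal.{max u v w}) (N : Type (max u v w))
    [L.Structure N] (φ : L.Formula (N ⊕ Unit)) : Prop :=
  (solutionSet φ).Nonempty ∧
    ∀ β : Ordinal.{max u v w}, β < α →
      ∃ (N' : Type (max u v w)) (_ : L.Structure N') (j : N ↪ₑ[L] N')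
        (ψ : ℕ → L.Formula (N' ⊕ Unit)),
        (∀ i, solutionSet (ψ i) ⊆ solutionSet (transport j φ)) ∧
        (Pairwise fun i k => Disjoint (solutionSet (ψ i)) (solutionSet (ψ k))) ∧
        ∀ i, FormulaRankGE L β N' (ψ i)
termination_by α

/-- The Morley rank of a subset `D` of the structure `B` that is definable with parameters in `B`:
`⊥` for the empty set, `⊤` if the rank is not an ordinal. -/
noncomputable def morleyRank (L : FirstOrder.Language.{u, v}) {B : Type w} [L.Structure B] (D : Set B) :
    WithBot (WithTop Ordinal.{max u v w}) :=
  sSup {r | ∃ α : Ordinal.{max u v w}, r = ((α : WithTop Ordinal.{max u v w}) : WithBot _) ∧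
    ∃ φ : L.Formula (B ⊕ Unit), solutionSet φ = D ∧
      ∃ (N : Type (max u v w)) (_ : L.Structure N) (j : B ↪ₑ[L] N),
        FormulaRankGE.{u, v, w} L α N (transport j φ)}

/-- The Morley degree of a definable subset `D` of `B`: the largest number of pairwise disjoint
definable subsets of `D`, each of the same Morley rank as `D`, in an elementary extension. -/
noncomputable def morleyDegree (L : FirstOrder.Language.{u, v}) {B : Type w} [L.Structure B] (D : Set B) :
    ℕ∞ :=
  sSup {n | ∃ d : ℕ, n = (d : ℕ∞) ∧
    ∃ φ : L.Formula (B ⊕ Unit), solutionSet φ = D ∧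
      ∃ (N : Type (max u v w)) (_ : L.Structure N) (j : B ↪ₑ[L] N)
        (ψ : Fin d → L.Formula (N ⊕ Unit)),
        (∀ i, solutionSet (ψ i) ⊆ solutionSet (transport j φ)) ∧
        (Pairwise fun i k => Disjoint (solutionSet (ψ i)) (solutionSet (ψ k))) ∧
        ∀ i, morleyRank.{u, v, max u v w} L (solutionSet (ψ i)) = morleyRank.{u, v, w} L D}

end ModelTheory

namespace KLoop

open ModelTheory

/-- The loop law is definable (with parameters) in the `L`-structure `B`. -/
def DefinableLaw (L : FirstOrder.Language.{u, v}) (B : Type w) [L.Structure B] [KLoop B] : Prop :=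
  (Set.univ : Set B).Definable L {t : Fin 3 → B | t 0 + t 1 = t 2}

/-- The subset `C` of `B` is b-connected: it contains no proper definable subloop of the same
Morley rank. -/
def BConnected (L : FirstOrder.Language.{u, v}) {B : Type w} [L.Structure B] [KLoop B] (C : Set B) : Prop :=
  ¬ ∃ D : Set B, D ⊂ C ∧ (Set.univ : Set B).Definable₁ L D ∧ IsSubloop D ∧
    morleyRank L D = morleyRank L C

/-- The subset `C` of `B` is connected (as a symétron): it contains no proper definable
sub-symétron of the same Morley rank. -/
def Connected (L : FirstOrder.Language.{u, v}) {B : Type w} [L.Structure B] [KLoop B] (C : Set B) : Prop :=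
  ¬ ∃ D : Set B, D ⊂ C ∧ (Set.univ : Set B).Definable₁ L D ∧ IsConvexSubset D ∧
    morleyRank L D = morleyRank L C

/-- `C` is a connected component of `B`: a connected definable subloop of the same Morley rank as
`B`. -/
def IsConnectedComponent (L : FirstOrder.Language.{u, v}) {B : Type w} [L.Structure B] [KLoop B]
    (C : Set B) : Prop :=
  (Set.univ : Set B).Definable₁ L C ∧ IsSubloop C ∧
    morleyRank L C = morleyRank L (Set.univ : Set B) ∧ Connected L C

end KLoop

/-!
Let `α` be the Morley rank of the K-loop `B` and `d` its Morley degree; ω-stability makes `α` an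
ordinal and `d` finite (`OmegaStable.exists_rank_degree`). Call a definable set *generic* if it has
rank `α`. The proof constructs a definable subloop `K` of `B`, closed under halving, whose images
under finitely many quadratic maps `x ↦ e + (x + e)` form a partition of `B` into `d` parts
(`exists_isQuadraticPartition`). Quadratic maps are definable bijections and preserve rank, so each
part is generic, and `K` does not contain two disjoint generic sets. The proposition follows.

* `K` is connected. If `D ⊆ K` is convex and generic and `y ∈ K`, the map that sends `v` to the
  centre of the symmetry taking `v` to `y` is a definable injection of `K` into itself. Hence `D`
  meets its image under this map, and convexity gives `y ∈ D`
  (`IsQuadraticPartition.subset_of_isConvexSubset`).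
* `K` is the only connected component. A component `C` lies in one part of the partition, because
  quadratic maps are automorphisms of the symétron; as `0 ∈ C`, that part is `K`
  (`IsQuadraticPartition.eq_of_forall_isConvexSubset`).
* Each of the three conditions is equivalent to `K = B`, that is, to `d = 1`.

To construct `K`, first pass to an ultrapower of `B` that contains `d` disjoint generic sets, so
that there are exactly `d` generic types. The left translations `λ_a` permute them, with
`λ_{a+(b+a)} = λ_a λ_b λ_a` by the Bol identity. Let `K` be the set of the `a` with `λ_a = 1`; it is
definable, since types over a stable structure are definable. Every element is a double, so squaring
is surjective, hence injective, on the finite set of the permutations `λ_a`; this shows that `K` is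
closed under halving and under sums (`isSubloop_genericKernel`) and that each fibre of `a ↦ λ_a` is
a quadratic image of `K`. A symmetry argument for generic types, based on the absence of definable
orders, shows that `K` belongs to at most one generic type (`eq_of_genericKernel_mem`), so there are
at least `d` fibres. Finally, `K` is given by a formula whose parameters are classes of sequences,
and almost all of the sets defined by the corresponding formulas over `B` inherit its properties
(`IsQuadraticPartition.of_ultrapower`).

Ranks are compared in different elementary extensions by amalgamation: any two of them embed in an
ultrapower of one over their common substructure (`exists_amalgam`). That the rank is an ordinal and
that the degree is finite is proved by building trees and sequences of formulas along elementary
chains, since no saturated model is available.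
-/

universe x y

/-! ### Ultrapowers and amalgamation -/

namespace ModelTheory

open FirstOrder FirstOrder.Language Filter

section Ultraproduct

variable {L : FirstOrder.Language.{u, v}} {I : Type*} {M : I → Type*}

/-- The class of a family in an ultraproduct. -/
def ultraMk (U : Ultrafilter I) (x : ∀ i, M i) : (U : Filter I).Product M :=
  (x : (U : Filter I).Product M)

theorem ultraMk_eq_iff {U : Ultrafilter I} {x y : ∀ i, M i} :
    ultraMk U x = ultraMk U y ↔ ∀ᶠ i in (U : Filter I), x i = y i :=
  Quotient.eq''

theorem ultraMk_congr {U : Ultrafilter I} {x y : ∀ i, M i} (h : ∀ i, x i = y i) :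
    ultraMk U x = ultraMk U y :=
  congrArg _ (funext h)

theorem exists_ultraMk (U : Ultrafilter I) (q : (U : Filter I).Product M) :
    ∃ x, ultraMk U x = q :=
  Quotient.exists_rep q

theorem realize_ultraMk [∀ i, L.Structure (M i)] [∀ i, Nonempty (M i)] (U : Ultrafilter I)
    {β : Type*} (φ : L.Formula β) (x : β → ∀ i, M i) :
    (φ.Realize fun b => ultraMk U (x b)) ↔ ∀ᶠ i in (U : Filter I), φ.Realize fun b => x b i :=
  Ultraproduct.realize_formula_cast φ x

/-- The ultrapower of `N` along `U`. -/
abbrev Ultrapower (U : Ultrafilter I) (N : Type*) := (U : Filter I).Product fun _ => N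

/-- The diagonal embedding of a structure in its ultrapower. -/
def diag (L : FirstOrder.Language.{u, v}) (U : Ultrafilter I) (N : Type*) [L.Structure N]
    [Nonempty N] : N ↪ₑ[L] Ultrapower U N where
  toFun x := ultraMk U fun _ => x
  map_formula' n φ x := by
    have h := realize_ultraMk U φ (fun (b : Fin n) (_ : I) => x b)
    rw [Filter.eventually_const] at h
    exact h

/-- If every formula true of the tuple `a₁` in `N₁` is true of the tuple `a₀` in `N₀`, then `N₁`
embeds elementarily in an ultrapower of `N₀` so that `a₁` goes to the diagonal image of `a₀`. The
index set consists of all maps `N₁ → N₀`, and an element `y` of `N₁` is represented by evaluation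
at `y`. -/
theorem exists_embedding_ultrapower {N₀ N₁ ι : Type*} [L.Structure N₀] [L.Structure N₁]
    [Nonempty N₀] (a₀ : ι → N₀) (a₁ : ι → N₁)
    (h : ∀ φ : L.Formula ι, φ.Realize a₁ → φ.Realize a₀) :
    ∃ (U : Ultrafilter (N₁ → N₀)) (k : N₁ ↪ₑ[L] Ultrapower U N₀),
      ∀ i, k (a₁ i) = diag L U N₀ (a₀ i) := by
  classical
  let T := {φ : L.Formula N₁ // φ.Realize (id : N₁ → N₁)} × Finset ι
  let S : T → Set (N₁ → N₀) := fun p => {g | p.1.1.Realize g ∧ ∀ i ∈ p.2, g (a₁ i) = a₀ i}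
  have hne : ∀ p : T, (S p).Nonempty := by
    rintro ⟨⟨φ, hφ⟩, F⟩
    let t : Finset N₁ := φ.freeVarFinset ∪ F.image a₁
    have hF : ∀ i : F, a₁ i ∈ t := fun i =>
      Finset.mem_union_right _ (Finset.mem_image_of_mem _ i.2)
    let φ' : L.Formula t :=
      φ.restrictFreeVar fun x => ⟨x, Finset.mem_union_left _ x.2⟩
    have hφ₁ : φ'.Realize (fun x : t => (x : N₁)) ↔ φ.Realize (id : N₁ → N₁) :=
      BoundedFormula.realize_restrictFreeVar id (by simp)
    have hφ₀ : ∀ g : N₁ → N₀, φ'.Realize (fun x : t => g x) ↔ φ.Realize g := fun g =>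
      BoundedFormula.realize_restrictFreeVar g (by simp)
    let χ : L.Formula (ι ⊕ t) := φ'.relabel Sum.inr ⊓
      Formula.iInf fun i : F =>
        (Term.var (Sum.inr ⟨a₁ i, hF i⟩)).equal (Term.var (Sum.inl (i : ι)))
    have h1 : (χ.iExs t).Realize a₁ := by
      rw [Formula.realize_iExs]
      refine ⟨fun x => x, ?_⟩
      simp only [χ, Formula.realize_inf, Formula.realize_relabel, Formula.realize_iInf,
        Formula.realize_equal, Term.realize_var, Sum.elim_inr, Sum.elim_inl]
      exact ⟨hφ₁.2 hφ, fun _ => trivial⟩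
    have h2 := h _ h1
    rw [Formula.realize_iExs] at h2
    obtain ⟨g, hg⟩ := h2
    simp only [χ, Formula.realize_inf, Formula.realize_relabel, Formula.realize_iInf,
        Formula.realize_equal, Term.realize_var, Sum.elim_inr, Sum.elim_inl] at hg
    let G : N₁ → N₀ := fun x => if hx : x ∈ t then g ⟨x, hx⟩ else Classical.arbitrary _
    have hG : (fun x : t => G x) = g := by
      funext x
      simp [G]
    refine ⟨G, (hφ₀ G).1 ?_, fun i hi => ?_⟩
    · rw [hG]
      exact hg.1
    · have := hg.2 ⟨i, hi⟩
      simp only [G, hF ⟨i, hi⟩, dif_pos]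
      exact this
  have hdir : Directed (· ≥ ·) fun p => 𝓟 (S p) := by
    rintro ⟨⟨φ, hφ⟩, F⟩ ⟨⟨φ', hφ'⟩, F'⟩
    refine ⟨⟨⟨φ ⊓ φ', Formula.realize_inf.2 ⟨hφ, hφ'⟩⟩, F ∪ F'⟩, ?_, ?_⟩
    all_goals
      simp only [ge_iff_le, Filter.le_principal_iff, Filter.mem_principal]
      rintro g ⟨hg, hg'⟩
      rw [Formula.realize_inf] at hg
    · exact ⟨hg.1, fun i hi => hg' i (Finset.mem_union_left _ hi)⟩
    · exact ⟨hg.2, fun i hi => hg' i (Finset.mem_union_right _ hi)⟩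
  have : Nonempty T := ⟨⟨⟨⊤, by simp⟩, ∅⟩⟩
  have hbot : (⨅ p, 𝓟 (S p)).NeBot :=
    Filter.iInf_neBot_of_directed' hdir fun p => Filter.principal_neBot_iff.2 (hne p)
  let U := Ultrafilter.of (⨅ p, 𝓟 (S p))
  have hU : ∀ p, S p ∈ (U : Filter (N₁ → N₀)) := fun p =>
    (Ultrafilter.of_le _).trans (iInf_le _ p) (Filter.mem_principal_self _)
  have htrue : ∀ φ : L.Formula N₁, φ.Realize (id : N₁ → N₁) →
      ∀ᶠ g in (U : Filter (N₁ → N₀)), φ.Realize g := fun φ hφ =>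
    Filter.mem_of_superset (hU ⟨⟨φ, hφ⟩, ∅⟩) fun g hg => hg.1
  refine ⟨U, ⟨fun y => ultraMk U fun g => g y, fun n φ x => ?_⟩, fun i => ?_⟩
  · have h1 := realize_ultraMk U φ fun (b : Fin n) (g : N₁ → N₀) => g (x b)
    have h2 : ∀ g : N₁ → N₀, (φ.relabel x).Realize g ↔ φ.Realize fun b => g (x b) := fun g =>
      Formula.realize_relabel
    have h3 : (φ.relabel x).Realize (id : N₁ → N₁) ↔ φ.Realize x := Formula.realize_relabel
    refine h1.trans ⟨fun H => ?_, fun H => ?_⟩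
    · by_contra hn
      have h4 := htrue (∼(φ.relabel x)) (by rw [Formula.realize_not, h3]; exact hn)
      obtain ⟨g, hg, hg'⟩ := (H.and h4).exists
      rw [Formula.realize_not, h2] at hg'
      exact hg' hg
    · exact (htrue _ (h3.2 H)).mono fun g hg => (h2 g).1 hg
  · refine ultraMk_eq_iff.2 (Filter.mem_of_superset (hU ⟨⟨⊤, by simp⟩, {i}⟩) fun g hg => ?_)
    exact hg.2 i (Finset.mem_singleton_self i)

/-- Amalgamation of two elementary extensions. -/
theorem exists_amalgam {N N₀ N₁ : Type*} [L.Structure N] [L.Structure N₀] [L.Structure N₁]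
    [Nonempty N₀] (j₀ : N ↪ₑ[L] N₀) (j₁ : N ↪ₑ[L] N₁) :
    ∃ (U : Ultrafilter (N₁ → N₀)) (k : N₁ ↪ₑ[L] Ultrapower U N₀),
      ∀ x, k (j₁ x) = diag L U N₀ (j₀ x) :=
  exists_embedding_ultrapower j₀ j₁ fun φ hφ => by
    have h1 := j₀.map_formula φ (id : N → N)
    have h2 := j₁.map_formula φ (id : N → N)
    exact h1.2 (h2.1 hφ)

/-- An elementary chain indexed by `ℕ` has an upper bound: the ultraproduct of its members along a
non-principal ultrafilter. -/
theorem exists_chain_bound {N : ℕ → Type w} [∀ n, L.Structure (N n)] [∀ n, Nonempty (N n)]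
    (j : ∀ n, N n ↪ₑ[L] N (n + 1)) :
    ∃ (M : Type w) (_ : L.Structure M) (k : ∀ n, N n ↪ₑ[L] M),
      ∀ n x, k (n + 1) (j n x) = k n x := by
  classical
  let J : ∀ m n, m ≤ n → (N m ↪ₑ[L] N n) := fun m n h =>
    Nat.leRec (motive := fun n _ => N m ↪ₑ[L] N n) (ElementaryEmbedding.refl L (N m))
      (fun n _ f => (j n).comp f) h
  have Jself : ∀ m, J m m le_rfl = ElementaryEmbedding.refl L (N m) := fun m => Nat.leRec_self _ _
  have Jsucc : ∀ m n (h : m ≤ n) x, J m (n + 1) (Nat.le_succ_of_le h) x = j n (J m n h x) := by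
    intro m n h x
    have : J m (n + 1) (Nat.le_succ_of_le h) = (j n).comp (J m n h) := Nat.leRec_succ _ _ h
    rw [this]
    rfl
  have Jcomp : ∀ m n (h : m + 1 ≤ n) x,
      J (m + 1) n h (j m x) = J m n ((Nat.le_succ m).trans h) x := by
    intro m n h x
    induction n, h using Nat.le_induction with
    | base =>
      rw [Jself, Jsucc m m le_rfl, Jself]
      rfl
    | succ n h ih => rw [Jsucc _ _ h, ih, Jsucc]
  let U : Ultrafilter ℕ := Filter.hyperfilter ℕ
  have hU : ∀ m, ∀ᶠ n in (U : Filter ℕ), m ≤ n := fun m =>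
    Nat.hyperfilter_le_atTop (Filter.eventually_ge_atTop m)
  let e : ∀ m, N m → ∀ n, N n := fun m x n =>
    if h : m ≤ n then J m n h x else Classical.arbitrary _
  have he : ∀ m n (h : m ≤ n) x, e m x n = J m n h x := fun m n h x => by simp [e, h]
  refine ⟨(U : Filter ℕ).Product N, inferInstance,
    fun m => ⟨fun x => ultraMk U (e m x), fun n φ x => ?_⟩, fun n x => ?_⟩
  · have h1 := realize_ultraMk U φ fun b => e m (x b)
    refine h1.trans ?_
    rw [← Filter.eventually_const (f := (U : Filter ℕ)) (p := φ.Realize x)]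
    refine Filter.eventually_congr ((hU m).mono fun n hn => ?_)
    simp only [he m n hn]
    exact (J m n hn).map_formula φ x
  · refine ultraMk_eq_iff.2 ((hU (n + 1)).mono fun k hk => ?_)
    rw [he _ _ hk, he _ _ ((Nat.le_succ n).trans hk), Jcomp]

end Ultraproduct

end ModelTheory

/-! ### Morley rank of formulas -/

namespace ModelTheory

open FirstOrder FirstOrder.Language Filter

section Transfer

theorem realize_relabel_map {L : FirstOrder.Language.{u, v}} {N N' : Type*} [L.Structure N']
    (j : N → N') {β : Type*} (χ : L.Formula (N ⊕ β)) (y : β → N') :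
    (χ.relabel (Sum.map j id)).Realize (Sum.elim id y) ↔ χ.Realize (Sum.elim j y) := by
  rw [Formula.realize_relabel, Sum.elim_comp_map]
  rfl

variable {L : FirstOrder.Language.{u, v}} {N N' N'' : Type*} [L.Structure N] [L.Structure N']
  [L.Structure N'']

theorem mem_solutionSet_transport (j : N ↪ₑ[L] N') (φ : L.Formula (N ⊕ Unit)) (x : N') :
    x ∈ solutionSet (transport j φ) ↔ φ.Realize (Sum.elim j fun _ => x) := by
  simp only [solutionSet, transport, Set.mem_ofPred_eq, Formula.realize_relabel, Sum.elim_comp_map]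
  rfl

/-- A universal statement with parameters in `N` holds in `N` if and only if it holds in an
elementary extension. -/
theorem forall_realize_iff (j : N ↪ₑ[L] N') {β : Type*} [Finite β] (φ : L.Formula (N ⊕ β)) :
    (∀ x : β → N', φ.Realize (Sum.elim j x)) ↔ ∀ x : β → N, φ.Realize (Sum.elim id x) := by
  rw [← Formula.realize_iAlls, ← Formula.realize_iAlls]
  exact j.map_formula (φ.iAlls β) (id : N → N)

theorem solutionSet_transport_subset (j : N ↪ₑ[L] N') {φ ψ : L.Formula (N ⊕ Unit)} :
    solutionSet (transport j φ) ⊆ solutionSet (transport j ψ) ↔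
      solutionSet φ ⊆ solutionSet ψ := by
  have h := forall_realize_iff j (φ.imp ψ)
  simp only [Formula.realize_imp] at h
  constructor
  · intro H x hx
    exact h.1 (fun y hy => (mem_solutionSet_transport j ψ (y ())).1
      (H ((mem_solutionSet_transport j φ (y ())).2 hy))) (fun _ => x) hx
  · intro H x hx
    exact (mem_solutionSet_transport j ψ x).2 (h.2 (fun y hy => H (a := y ()) hy) (fun _ => x)
      ((mem_solutionSet_transport j φ x).1 hx))

theorem solutionSet_transport_congr (j : N ↪ₑ[L] N') {φ ψ : L.Formula (N ⊕ Unit)}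
    (h : solutionSet φ = solutionSet ψ) :
    solutionSet (transport j φ) = solutionSet (transport j ψ) :=
  Set.Subset.antisymm ((solutionSet_transport_subset j).2 h.le)
    ((solutionSet_transport_subset j).2 h.ge)

theorem solutionSet_bot : solutionSet (⊥ : L.Formula (N ⊕ Unit)) = ∅ := by
  ext x
  simp [solutionSet]

theorem solutionSet_top : solutionSet (⊤ : L.Formula (N ⊕ Unit)) = Set.univ := by
  ext x
  simp [solutionSet]

theorem solutionSet_inf (φ ψ : L.Formula (N ⊕ Unit)) :
    solutionSet (φ ⊓ ψ) = solutionSet φ ∩ solutionSet ψ := by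
  ext x
  exact Formula.realize_inf

theorem solutionSet_sup (φ ψ : L.Formula (N ⊕ Unit)) :
    solutionSet (φ ⊔ ψ) = solutionSet φ ∪ solutionSet ψ := by
  ext x
  exact Formula.realize_sup

theorem solutionSet_not (φ : L.Formula (N ⊕ Unit)) :
    solutionSet (∼φ) = (solutionSet φ)ᶜ := by
  ext x
  exact Formula.realize_not

theorem solutionSet_transport_sup (j : N ↪ₑ[L] N') (φ ψ : L.Formula (N ⊕ Unit)) :
    solutionSet (transport j (φ ⊔ ψ)) = solutionSet (transport j φ) ∪ solutionSet (transport j ψ) :=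
  by
  ext x
  simp only [Set.mem_union, mem_solutionSet_transport, Formula.realize_sup]

theorem solutionSet_transport_top (j : N ↪ₑ[L] N') :
    solutionSet (transport j (⊤ : L.Formula (N ⊕ Unit))) = Set.univ := by
  ext x
  simp [mem_solutionSet_transport]

theorem solutionSet_transport_disjoint (j : N ↪ₑ[L] N') {φ ψ : L.Formula (N ⊕ Unit)} :
    Disjoint (solutionSet (transport j φ)) (solutionSet (transport j ψ)) ↔
      Disjoint (solutionSet φ) (solutionSet ψ) := by
  have h := solutionSet_transport_subset j (φ := φ) (ψ := ∼ψ)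
  have hn : solutionSet (transport j (∼ψ)) = (solutionSet (transport j ψ))ᶜ := by
    ext x
    simp [mem_solutionSet_transport]
  rw [solutionSet_not, hn, Set.subset_compl_iff_disjoint_right,
    Set.subset_compl_iff_disjoint_right] at h
  exact h

theorem solutionSet_transport_nonempty (j : N ↪ₑ[L] N') {φ : L.Formula (N ⊕ Unit)} :
    (solutionSet (transport j φ)).Nonempty ↔ (solutionSet φ).Nonempty := by
  have h := solutionSet_transport_subset j (φ := φ) (ψ := ⊥)
  have hb : solutionSet (transport j (⊥ : L.Formula (N ⊕ Unit))) = ∅ := by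
    ext x
    simp [mem_solutionSet_transport]
  rw [solutionSet_bot, hb, Set.subset_empty_iff, Set.subset_empty_iff] at h
  rw [Set.nonempty_iff_ne_empty, Set.nonempty_iff_ne_empty, not_iff_not, h]

/-- Two ways of transporting a formula along composites agree when the composites do. -/
theorem solutionSet_transport_transport {N₁ : Type*} [L.Structure N₁] (j : N ↪ₑ[L] N')
    (k : N' ↪ₑ[L] N'') (j₁ : N ↪ₑ[L] N₁) (k₁ : N₁ ↪ₑ[L] N'') (h : ∀ x, k (j x) = k₁ (j₁ x))
    (φ : L.Formula (N ⊕ Unit)) :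
    solutionSet (transport k (transport j φ)) = solutionSet (transport k₁ (transport j₁ φ)) := by
  ext x
  rw [mem_solutionSet_transport, mem_solutionSet_transport]
  simp only [transport, Formula.realize_relabel, Sum.elim_comp_map]
  have : (k ∘ j : N → N'') = k₁ ∘ j₁ := funext h
  rw [this]

theorem solutionSet_transport_comp (j : N ↪ₑ[L] N') (k : N' ↪ₑ[L] N'') (i : N ↪ₑ[L] N'')
    (h : ∀ x, k (j x) = i x) (φ : L.Formula (N ⊕ Unit)) :
    solutionSet (transport k (transport j φ)) = solutionSet (transport i φ) := by
  ext x
  rw [mem_solutionSet_transport, mem_solutionSet_transport]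
  simp only [transport, Formula.realize_relabel, Sum.elim_comp_map]
  have : (k ∘ j : N → N'') = i := funext h
  rw [this, Function.comp_id]

/-- The formula defining the image of the set defined by `φ` under the relation defined by `χ`. -/
noncomputable def imageFormula (χ : L.Formula (N ⊕ Fin 2)) (φ : L.Formula (N ⊕ Unit)) :
    L.Formula (N ⊕ Unit) :=
  ((φ.relabel (Sum.elim (Sum.inl ∘ Sum.inl) fun _ => Sum.inr ()) : L.Formula ((N ⊕ Unit) ⊕ Unit)) ⊓
    χ.relabel (Sum.elim (Sum.inl ∘ Sum.inl) ![Sum.inr (), Sum.inl (Sum.inr ())])).iExs Unit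

theorem mem_solutionSet_transport_imageFormula (j : N ↪ₑ[L] N') (χ : L.Formula (N ⊕ Fin 2))
    (φ : L.Formula (N ⊕ Unit)) (y : N') :
    y ∈ solutionSet (transport j (imageFormula χ φ)) ↔
      ∃ x ∈ solutionSet (transport j φ), χ.Realize (Sum.elim j ![x, y]) := by
  have e₁ : ∀ i : Unit → N', (Sum.elim (Sum.elim (j : N → N') fun _ => y) i) ∘
      (Sum.elim (Sum.inl ∘ Sum.inl) fun _ => Sum.inr () :
        N ⊕ Unit → (N ⊕ Unit) ⊕ Unit) = Sum.elim j fun _ => i () := by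
    intro i
    funext b
    rcases b with b | b <;> rfl
  have e₂ : ∀ i : Unit → N', (Sum.elim (Sum.elim (j : N → N') fun _ => y) i) ∘
      (Sum.elim (Sum.inl ∘ Sum.inl) ![Sum.inr (), Sum.inl (Sum.inr ())] :
        N ⊕ Fin 2 → (N ⊕ Unit) ⊕ Unit) =
        Sum.elim j ![i (), y] := by
    intro i
    funext b
    rcases b with b | b
    · rfl
    · fin_cases b <;> rfl
  rw [mem_solutionSet_transport, imageFormula, Formula.realize_iExs]
  simp only [Formula.realize_inf, Formula.realize_relabel, mem_solutionSet_transport, e₁, e₂]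
  exact ⟨fun ⟨i, h⟩ => ⟨i (), h⟩, fun ⟨x, h⟩ => ⟨fun _ => x, h⟩⟩

theorem mem_solutionSet_imageFormula (χ : L.Formula (N ⊕ Fin 2))
    (φ : L.Formula (N ⊕ Unit)) (y : N) :
    y ∈ solutionSet (imageFormula χ φ) ↔
      ∃ x ∈ solutionSet φ, χ.Realize (Sum.elim id ![x, y]) := by
  have h := mem_solutionSet_transport_imageFormula (ElementaryEmbedding.refl L N) χ φ y
  have e : ∀ ψ : L.Formula (N ⊕ Unit),
      solutionSet (transport (ElementaryEmbedding.refl L N) ψ) = solutionSet ψ := by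
    intro ψ
    ext x
    rw [mem_solutionSet_transport]
    rfl
  rw [e, e] at h
  exact h

/-- The relation defined by `χ` is total and injective. -/
def IsInjectiveRelation (χ : L.Formula (N ⊕ Fin 2)) : Prop :=
  (∀ x, ∃ y, χ.Realize (Sum.elim id ![x, y])) ∧
    ∀ x x' y, χ.Realize (Sum.elim id ![x, y]) → χ.Realize (Sum.elim id ![x', y]) → x = x'

theorem IsInjectiveRelation.transport (j : N ↪ₑ[L] N') {χ : L.Formula (N ⊕ Fin 2)}
    (h : IsInjectiveRelation χ) :
    IsInjectiveRelation (χ.relabel (Sum.map j id) : L.Formula (N' ⊕ Fin 2)) := by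
  constructor
  · have h1 := forall_realize_iff j (β := Unit)
      ((χ.relabel (Sum.elim (Sum.inl ∘ Sum.inl) ![Sum.inl (Sum.inr ()), Sum.inr ()]) :
        L.Formula ((N ⊕ Unit) ⊕ Unit)).iExs Unit)
    simp only [Formula.realize_iExs, Formula.realize_relabel] at h1
    intro x
    have h2 := h1.2 (fun x => by
      obtain ⟨y, hy⟩ := h.1 (x ())
      refine ⟨fun _ => y, ?_⟩
      convert hy using 1
      funext b
      rcases b with b | b
      · rfl
      · fin_cases b <;> rfl) (fun _ => x)
    obtain ⟨y, hy⟩ := h2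
    refine ⟨y (), ?_⟩
    rw [realize_relabel_map]
    convert hy using 1
    funext b
    rcases b with b | b
    · rfl
    · fin_cases b <;> rfl
  · have h1 := forall_realize_iff j (β := Fin 3)
      ((χ.relabel (Sum.map id ![0, 2])).imp ((χ.relabel (Sum.map id ![1, 2])).imp
        ((Term.var (Sum.inr 0)).equal (Term.var (Sum.inr 1)))))
    simp only [Formula.realize_imp, Formula.realize_relabel, Formula.realize_equal,
      Term.realize_var, Sum.elim_inr, Sum.elim_comp_map, Function.comp_id] at h1
    intro x x' y hx hx'
    rw [realize_relabel_map] at hx hx'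
    refine h1.2 (fun z h2 h3 => ?_) ![x, x', y] ?_ ?_
    · refine h.2 (z 0) (z 1) (z 2) ?_ ?_
      · convert h2 using 2
        funext i; fin_cases i <;> rfl
      · convert h3 using 2
        funext i; fin_cases i <;> rfl
    · convert hx using 2
      funext i; fin_cases i <;> rfl
    · convert hx' using 2
      funext i; fin_cases i <;> rfl

end Transfer

section Rank

variable {L : FirstOrder.Language.{u, v}} {N : Type (max u v w)} [L.Structure N]
  {α β : Ordinal.{max u v w}}

theorem formulaRankGE_iff {φ : L.Formula (N ⊕ Unit)} :
    FormulaRankGE.{u, v, w} L α N φ ↔ (solutionSet φ).Nonempty ∧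
      ∀ β : Ordinal.{max u v w}, β < α →
        ∃ (N' : Type (max u v w)) (_ : L.Structure N') (j : N ↪ₑ[L] N')
          (ψ : ℕ → L.Formula (N' ⊕ Unit)),
          (∀ i, solutionSet (ψ i) ⊆ solutionSet (transport j φ)) ∧
          (Pairwise fun i k => Disjoint (solutionSet (ψ i)) (solutionSet (ψ k))) ∧
          ∀ i, FormulaRankGE.{u, v, w} L β N' (ψ i) := by
  rw [FormulaRankGE]

theorem FormulaRankGE.nonempty {φ : L.Formula (N ⊕ Unit)} (h : FormulaRankGE.{u, v, w} L α N φ) :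
    (solutionSet φ).Nonempty :=
  (formulaRankGE_iff.1 h).1

theorem FormulaRankGE.mono {φ ψ : L.Formula (N ⊕ Unit)} (h : FormulaRankGE.{u, v, w} L α N φ)
    (hs : solutionSet φ ⊆ solutionSet ψ) : FormulaRankGE.{u, v, w} L α N ψ := by
  rw [formulaRankGE_iff] at h ⊢
  refine ⟨h.1.mono hs, fun β hβ => ?_⟩
  obtain ⟨N', _, j, χ, h1, h2, h3⟩ := h.2 β hβ
  exact ⟨N', _, j, χ, fun i => (h1 i).trans ((solutionSet_transport_subset j).2 hs), h2, h3⟩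

theorem FormulaRankGE.of_le {φ : L.Formula (N ⊕ Unit)} (h : FormulaRankGE.{u, v, w} L α N φ)
    (hβ : β ≤ α) : FormulaRankGE.{u, v, w} L β N φ := by
  rw [formulaRankGE_iff] at h ⊢
  exact ⟨h.1, fun γ hγ => h.2 γ (hγ.trans_le hβ)⟩

theorem FormulaRankGE.of_transport {N' : Type (max u v w)} [L.Structure N'] (j : N ↪ₑ[L] N')
    {φ : L.Formula (N ⊕ Unit)} (h : FormulaRankGE.{u, v, w} L α N' (transport j φ)) :
    FormulaRankGE.{u, v, w} L α N φ := by
  rw [formulaRankGE_iff] at h ⊢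
  refine ⟨(solutionSet_transport_nonempty j).1 h.1, fun β hβ => ?_⟩
  obtain ⟨N₁, _, k, χ, h1, h2, h3⟩ := h.2 β hβ
  refine ⟨N₁, _, k.comp j, χ, fun i => (h1 i).trans ?_, h2, h3⟩
  rw [solutionSet_transport_comp j k (k.comp j) fun _ => rfl]

/-- The rank does not drop in an elementary extension `N'` of `N`: an extension of `N` that contains
an infinite family is amalgamated with `N'`. -/
theorem FormulaRankGE.transport (α : Ordinal.{max u v w}) :
    ∀ {N N' : Type (max u v w)} [L.Structure N] [L.Structure N'] (j : N ↪ₑ[L] N')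
      {φ : L.Formula (N ⊕ Unit)}, FormulaRankGE.{u, v, w} L α N φ →
      FormulaRankGE.{u, v, w} L α N' (transport j φ) := by
  induction α using WellFoundedLT.induction with
  | _ α ih =>
    intro N N' _ _ j φ h
    rw [formulaRankGE_iff] at h ⊢
    refine ⟨(solutionSet_transport_nonempty j).2 h.1, fun β hβ => ?_⟩
    obtain ⟨N₁, _, k, χ, h1, h2, h3⟩ := h.2 β hβ
    have : Nonempty N' := ⟨j h.1.some⟩
    obtain ⟨U, i, hi⟩ := exists_amalgam j k
    refine ⟨Ultrapower U N', inferInstance, diag L U N', fun n => ModelTheory.transport i (χ n),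
      fun n => ?_, fun n m hnm => (solutionSet_transport_disjoint i).2 (h2 hnm),
      fun n => ih β hβ i (h3 n)⟩
    rw [← solutionSet_transport_transport k i j (diag L U N') hi]
    exact (solutionSet_transport_subset i).2 (h1 n)

theorem formulaRankGE_transport_iff {N' : Type (max u v w)} [L.Structure N'] (j : N ↪ₑ[L] N')
    {φ : L.Formula (N ⊕ Unit)} :
    FormulaRankGE.{u, v, w} L α N' (transport j φ) ↔ FormulaRankGE.{u, v, w} L α N φ :=
  ⟨.of_transport j, .transport α j⟩

/-- The rank of a union is the maximum of the ranks. If the first set fails to have the required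
infinite family at some `β₀`, then from `β₀` on each family must have infinitely many members
whose trace on the second set keeps the rank. -/
theorem FormulaRankGE.or_of_sup (α : Ordinal.{max u v w}) :
    ∀ {N : Type (max u v w)} [L.Structure N] {φ ψ : L.Formula (N ⊕ Unit)},
      FormulaRankGE.{u, v, w} L α N (φ ⊔ ψ) →
      FormulaRankGE.{u, v, w} L α N φ ∨ FormulaRankGE.{u, v, w} L α N ψ := by
  induction α using WellFoundedLT.induction with
  | _ α ih =>
    intro N _ φ ψ h
    rw [formulaRankGE_iff] at h
    -- the required family for `β`, in `φ` or in `ψ`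
    let F : L.Formula (N ⊕ Unit) → Ordinal.{max u v w} → Prop := fun φ β =>
      ∃ (N' : Type (max u v w)) (_ : L.Structure N') (j : N ↪ₑ[L] N')
        (χ : ℕ → L.Formula (N' ⊕ Unit)),
        (∀ i, solutionSet (χ i) ⊆ solutionSet (ModelTheory.transport j φ)) ∧
        (Pairwise fun i k => Disjoint (solutionSet (χ i)) (solutionSet (χ k))) ∧
        ∀ i, FormulaRankGE.{u, v, w} L β N' (χ i)
    have hF : ∀ φ β, F φ β → (solutionSet φ).Nonempty := by
      rintro φ β ⟨N', _, j, χ, h1, h2, h3⟩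
      exact (solutionSet_transport_nonempty j).1 ((h3 0).nonempty.mono (h1 0))
    have hle : ∀ φ β γ, F φ β → γ ≤ β → F φ γ := by
      rintro φ β γ ⟨N', _, j, χ, h1, h2, h3⟩ hγ
      exact ⟨N', _, j, χ, h1, h2, fun i => (h3 i).of_le hγ⟩
    have key : ∀ β < α, F φ β ∨ F ψ β := by
      intro β hβ
      obtain ⟨N', _, j, χ, h1, h2, h3⟩ := h.2 β hβ
      have hs : ∀ i, FormulaRankGE.{u, v, w} L β N' (χ i ⊓ ModelTheory.transport j φ) ∨
          FormulaRankGE.{u, v, w} L β N' (χ i ⊓ ModelTheory.transport j ψ) := by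
        intro i
        refine ih β hβ ((h3 i).mono ?_)
        rw [solutionSet_sup, solutionSet_inf, solutionSet_inf, ← Set.inter_union_distrib_left,
          ← solutionSet_transport_sup]
        exact Set.subset_inter subset_rfl (h1 i)
      have hfam : ∀ θ : L.Formula (N ⊕ Unit),
          {i | FormulaRankGE.{u, v, w} L β N' (χ i ⊓ ModelTheory.transport j θ)}.Infinite →
            F θ β := by
        intro θ hinf
        have := hinf.to_subtype
        classical
        let e := Nat.orderEmbeddingOfSet {i | FormulaRankGE.{u, v, w} L β N'
          (χ i ⊓ ModelTheory.transport j θ)}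
        refine ⟨N', _, j, fun n => χ (e n) ⊓ ModelTheory.transport j θ, fun n => ?_,
          fun n m hnm => ?_, fun n => ?_⟩
        · rw [solutionSet_inf]
          exact Set.inter_subset_right
        · simp only [solutionSet_inf]
          exact (h2 (e.injective.ne hnm)).mono Set.inter_subset_left Set.inter_subset_left
        · exact (Nat.orderEmbeddingOfSet_range {i | FormulaRankGE.{u, v, w} L β N'
            (χ i ⊓ ModelTheory.transport j θ)}).le ⟨n, rfl⟩
      by_cases hφ : {i | FormulaRankGE.{u, v, w} L β N' (χ i ⊓ ModelTheory.transport j φ)}.Infinite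
      · exact Or.inl (hfam φ hφ)
      · refine Or.inr (hfam ψ ?_)
        have : {i | FormulaRankGE.{u, v, w} L β N' (χ i ⊓ ModelTheory.transport j φ)}ᶜ.Infinite :=
          Set.Finite.infinite_compl (Set.not_infinite.1 hφ)
        exact this.mono fun i hi => (hs i).resolve_left hi
    by_cases hall : ∀ β < α, F φ β
    · by_cases hne : (solutionSet φ).Nonempty
      · exact Or.inl (formulaRankGE_iff.2 ⟨hne, hall⟩)
      · refine Or.inr (formulaRankGE_iff.2 ⟨?_, fun β hβ => absurd (hF φ β (hall β hβ)) hne⟩)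
        have := h.1
        rw [solutionSet_sup, Set.not_nonempty_iff_eq_empty.1 hne, Set.empty_union] at this
        exact this
    · push Not at hall
      obtain ⟨β₀, hβ₀, hn⟩ := hall
      have hψ : ∀ β < α, F ψ β := by
        intro β hβ
        rcases le_total β₀ β with hle' | hle'
        · exact (key β hβ).resolve_left fun hc => hn (hle φ β β₀ hc hle')
        · exact hle ψ β₀ β ((key β₀ hβ₀).resolve_left hn) hle'
      exact Or.inr (formulaRankGE_iff.2 ⟨hF ψ β₀ (hψ β₀ hβ₀), hψ⟩)

/-- A definable injection does not decrease the rank. -/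
theorem FormulaRankGE.image (α : Ordinal.{max u v w}) :
    ∀ {N : Type (max u v w)} [L.Structure N] {χ : L.Formula (N ⊕ Fin 2)}
      {φ : L.Formula (N ⊕ Unit)}, IsInjectiveRelation χ → FormulaRankGE.{u, v, w} L α N φ →
      FormulaRankGE.{u, v, w} L α N (imageFormula χ φ) := by
  induction α using WellFoundedLT.induction with
  | _ α ih =>
    intro N _ χ φ hχ h
    rw [formulaRankGE_iff] at h ⊢
    constructor
    · obtain ⟨x, hx⟩ := h.1
      obtain ⟨y, hy⟩ := hχ.1 x
      exact ⟨y, (mem_solutionSet_imageFormula χ φ y).2 ⟨x, hx, hy⟩⟩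
    · intro β hβ
      obtain ⟨N', _, j, ψ, h1, h2, h3⟩ := h.2 β hβ
      have hχ' := hχ.transport j
      refine ⟨N', _, j, fun i => imageFormula (χ.relabel (Sum.map j id)) (ψ i), fun i y hy => ?_,
        fun i k hik => ?_, fun i => ih β hβ hχ' (h3 i)⟩
      · obtain ⟨x, hx, hxy⟩ := (mem_solutionSet_imageFormula _ _ y).1 hy
        rw [mem_solutionSet_transport_imageFormula]
        exact ⟨x, h1 i hx, (realize_relabel_map j χ _).1 hxy⟩
      · refine Set.disjoint_left.2 ?_
        intro y hy hy'
        obtain ⟨x, hx, hxy⟩ := (mem_solutionSet_imageFormula _ _ y).1 hy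
        obtain ⟨x', hx', hxy'⟩ := (mem_solutionSet_imageFormula _ _ y).1 hy'
        have := hχ'.2 x x' y hxy hxy'
        subst this
        exact Set.disjoint_left.1 (h2 hik) hx hx'

end Rank

end ModelTheory

/-! ### Consequences of ω-stability -/

namespace ModelTheory

open FirstOrder FirstOrder.Language Filter

section Definable

variable {L : FirstOrder.Language.{u, v}} {N : Type*} [L.Structure N]

theorem definable_iff_exists_formula {α : Type*} {S : Set (α → N)} :
    (Set.univ : Set N).Definable L S ↔
      ∃ φ : L.Formula (N ⊕ α), ∀ x, x ∈ S ↔ φ.Realize (Sum.elim id x) := by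
  rw [Set.definable_iff_exists_formula_sum]
  constructor
  · rintro ⟨φ, rfl⟩
    refine ⟨φ.relabel (Sum.map (↑) id), fun x => ?_⟩
    rw [Formula.realize_relabel, Sum.elim_comp_map]
    rfl
  · rintro ⟨φ, hφ⟩
    refine ⟨φ.relabel (Sum.map (fun x => ⟨x, trivial⟩) id), Set.ext fun x => ?_⟩
    rw [hφ, Set.mem_ofPred_eq, Formula.realize_relabel, Sum.elim_comp_map]
    rfl

theorem definable₁_iff_exists_solutionSet {D : Set N} :
    (Set.univ : Set N).Definable₁ L D ↔ ∃ φ : L.Formula (N ⊕ Unit), solutionSet φ = D := by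
  rw [Set.Definable₁, definable_iff_exists_formula]
  constructor
  · rintro ⟨φ, hφ⟩
    refine ⟨φ.relabel (Sum.map id fun _ => ()), Set.ext fun x => ?_⟩
    rw [solutionSet, Set.mem_ofPred_eq, Formula.realize_relabel, Sum.elim_comp_map]
    exact (hφ fun _ => x).symm
  · rintro ⟨φ, rfl⟩
    refine ⟨φ.relabel (Sum.map id fun _ => 0), fun x => ?_⟩
    rw [solutionSet, Set.mem_ofPred_eq, Formula.realize_relabel, Sum.elim_comp_map]
    rfl

theorem definable₁_solutionSet (φ : L.Formula (N ⊕ Unit)) :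
    (Set.univ : Set N).Definable₁ L (solutionSet φ) :=
  definable₁_iff_exists_solutionSet.2 ⟨φ, rfl⟩

theorem realize_diag_ultraMk {I : Type*} (U : Ultrafilter I) [Nonempty N] {β : Type*}
    (φ : L.Formula (N ⊕ β)) (x : β → I → N) :
    φ.Realize (Sum.elim (diag L U N) fun b => ultraMk U (x b)) ↔
      ∀ᶠ i in (U : Filter I), φ.Realize (Sum.elim id fun b => x b i) := by
  have h := realize_ultraMk U φ (Sum.elim (fun (c : N) (_ : I) => c) x)
  have e : (fun b => ultraMk U (Sum.elim (fun (c : N) (_ : I) => c) x b)) =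
      Sum.elim (diag L U N) fun b => ultraMk U (x b) := by
    funext b
    cases b <;> rfl
  rw [e] at h
  rw [h]
  refine Filter.eventually_congr (Filter.Eventually.of_forall fun i => iff_of_eq (congrArg _ ?_))
  funext b
  cases b <;> rfl

end Definable

section Stable

variable {L : FirstOrder.Language.{u, v}} {B : Type w} [L.Structure B]
  {N : Type (max u v w)} [L.Structure N]

theorem model_of_elementaryEmbedding {M : Type*} [L.Structure M] {N : Type*} [L.Structure N]
    (j : M ↪ₑ[L] N) {T : L.Theory} (h : M ⊨ T) : N ⊨ T :=
  (j.theory_model_iff T).1 h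

/-- Uncountably many points pairwise separated by countably many definable sets have pairwise
distinct types over the countable set of parameters involved. -/
theorem OmegaStable.not_separated (hs : OmegaStable.{u, v, w} L B)
    (hN : N ⊨ L.completeTheory B) [Nonempty N] {ι κ : Type*} [Uncountable ι] [Countable κ]
    (x : ι → N) (D : κ → Set N) (hD : ∀ k, (Set.univ : Set N).Definable₁ L (D k))
    (hsep : ∀ i i', i ≠ i' → ∃ k, ¬(x i ∈ D k ↔ x i' ∈ D k)) : False := by
  have hfin : ∀ k, ∃ A : Finset N, (A : Set N).Definable₁ L (D k) := fun k =>
    let ⟨A, _, hA⟩ := Set.definable_iff_finitely_definable.1 (hD k)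
    ⟨A, hA⟩
  choose A hA using hfin
  let C : Set N := ⋃ k, (A k : Set N)
  have hC : C.Countable := Set.countable_iUnion fun k => (A k).countable_toSet
  have hCD : ∀ k, C.Definable₁ L (D k) := fun k =>
    (hA k).mono (Set.subset_iUnion (fun k => (A k : Set N)) k)
  have hcount := hs N hN C hC
  let f : ι → (L[[C]].completeTheory N).CompleteType Unit := fun i =>
    (L[[C]].completeTheory N).typeOf fun _ => x i
  have hf : Function.Injective f := by
    intro i i' h
    by_contra hne
    obtain ⟨k, hk⟩ := hsep i i' hne
    obtain ⟨φ, hφ⟩ := hCD k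
    have hφ' : ∀ y, y ∈ D k ↔ (φ.relabel fun _ => () : L[[C]].Formula Unit).Realize fun _ => y := by
      intro y
      rw [Formula.realize_relabel]
      have := Set.ext_iff.1 hφ fun _ => y
      exact this
    refine hk ?_
    rw [hφ', hφ', ← Theory.CompleteType.formula_mem_typeOf (T := L[[C]].completeTheory N),
      ← Theory.CompleteType.formula_mem_typeOf (T := L[[C]].completeTheory N)]
    exact iff_of_eq (congrArg (fun p => _ ∈ p) h)
  exact not_countable (hf.countable : Countable ι)

/-- The path of length `n` along the branch `f` of the binary tree. -/
def branch (f : ℕ → Bool) : ℕ → List Bool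
  | 0 => []
  | n + 1 => f n :: branch f n

theorem branch_congr {f g : ℕ → Bool} {n : ℕ} (h : ∀ m < n, f m = g m) :
    branch f n = branch g n := by
  induction n with
  | zero => rfl
  | succ n ih =>
    rw [branch, branch, h n n.lt_succ_self, ih fun m hm => h m (hm.trans n.lt_succ_self)]

/-- There is no binary tree of non-empty definable sets with disjoint siblings. -/
theorem OmegaStable.not_tree (hs : OmegaStable.{u, v, w} L B)
    (hN : N ⊨ L.completeTheory B) (φ : List Bool → L.Formula (N ⊕ Unit))
    (hne : ∀ s, (solutionSet (φ s)).Nonempty)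
    (hsub : ∀ b s, solutionSet (φ (b :: s)) ⊆ solutionSet (φ s))
    (hdisj : ∀ s, Disjoint (solutionSet (φ (true :: s))) (solutionSet (φ (false :: s)))) :
    False := by
  have : Nonempty N := ⟨(hne []).some⟩
  let U : Ultrafilter ℕ := Filter.hyperfilter ℕ
  have hU : ∀ m, ∀ᶠ n in (U : Filter ℕ), m ≤ n := fun m =>
    Nat.hyperfilter_le_atTop (Filter.eventually_ge_atTop m)
  let j := diag L U N
  let x : (ℕ → Bool) → Ultrapower U N := fun f => ultraMk U fun n => (hne (branch f n)).some
  have hanti : ∀ f m n, m ≤ n → solutionSet (φ (branch f n)) ⊆ solutionSet (φ (branch f m)) := by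
    intro f m n h
    induction n, h using Nat.le_induction with
    | base => exact subset_rfl
    | succ n _ ih => exact (hsub _ _).trans ih
  have hx : ∀ f m, x f ∈ solutionSet (transport j (φ (branch f m))) := by
    intro f m
    rw [mem_solutionSet_transport]
    refine (realize_diag_ultraMk U (φ (branch f m))
      (fun (_ : Unit) n => (hne (branch f n)).some)).2 ((hU m).mono fun n hn => ?_)
    exact hanti f m n hn (hne (branch f n)).some_mem
  have : Uncountable (ℕ → Bool) := by
    rw [← Cardinal.aleph0_lt_mk_iff]
    simpa using Cardinal.cantor Cardinal.aleph0
  refine hs.not_separated (N := Ultrapower U N) (model_of_elementaryEmbedding j hN) x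
    (fun s => solutionSet (transport j (φ s))) (fun s => definable₁_solutionSet _) ?_
  intro f g hfg
  have hex : ∃ n, f n ≠ g n := Function.ne_iff.1 hfg
  classical
  let n := Nat.find hex
  have hn : f n ≠ g n := Nat.find_spec hex
  have hb : branch f n = branch g n := branch_congr fun m hm => not_not.1 (Nat.find_min hex hm)
  refine ⟨branch f (n + 1), fun H => ?_⟩
  have h1 := H.1 (hx f (n + 1))
  have h2 := hx g (n + 1)
  rw [branch] at h1 h2
  rw [← hb] at h2
  have hd : Disjoint (solutionSet (transport j (φ (f n :: branch f n))))
      (solutionSet (transport j (φ (g n :: branch f n)))) := by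
    rw [solutionSet_transport_disjoint]
    cases hf : f n <;> cases hg : g n
    · exact absurd (hf.trans hg.symm) hn
    · exact (hdisj _).symm
    · exact hdisj _
    · exact absurd (hf.trans hg.symm) hn
  exact Set.disjoint_left.1 hd h1 h2

/-- A definable relation on a model of an `ω`-stable theory does not order an infinite sequence
of pairs. In an ultrapower indexed by `ℕ` such a sequence can be stretched along the real line: the
classes of `n ↦ a (2 * ⌊exp r * n⌋)`, for real `r`, are separated by the classes of
`n ↦ b (2 * ⌊exp q * n⌋ + 1)`, for rational `q`. -/
theorem OmegaStable.not_order (hs : OmegaStable.{u, v, w} L B)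
    (hN : N ⊨ L.completeTheory B) {R : Set (N × N)} (hR : (Set.univ : Set N).Definable₂ L R)
    (a b : ℕ → N) (h₁ : ∀ m n, m < n → (a m, b n) ∈ R) (h₂ : ∀ m n, n < m → (a m, b n) ∉ R) :
    False := by
  have : Nonempty N := ⟨a 0⟩
  obtain ⟨ρ, hρ⟩ := definable_iff_exists_formula.1 hR
  have hρ' : ∀ x y, ρ.Realize (Sum.elim id ![x, y]) ↔ (x, y) ∈ R := fun x y => (hρ ![x, y]).symm
  let U : Ultrafilter ℕ := Filter.hyperfilter ℕ
  let j := diag L U N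
  let i : ℝ → ℕ → ℕ := fun r n => ⌊Real.exp r * n⌋₊
  let x : ℝ → Ultrapower U N := fun r => ultraMk U fun n => a (2 * i r n)
  let y : ℚ → Ultrapower U N := fun q => ultraMk U fun n => b (2 * i q n + 1)
  let D : ℚ → Set (Ultrapower U N) := fun q => {z | ρ.Realize (Sum.elim j ![z, y q])}
  have hD : ∀ q, (Set.univ : Set (Ultrapower U N)).Definable₁ L (D q) := by
    intro q
    refine definable_iff_exists_formula.2
      ⟨ρ.relabel (Sum.elim (Sum.inl ∘ j) ![Sum.inr 0, Sum.inl (y q)]), fun z => ?_⟩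
    rw [Formula.realize_relabel]
    refine iff_of_eq (congrArg ρ.Realize ?_)
    funext c
    rcases c with c | c
    · rfl
    · fin_cases c <;> rfl
  have hmem : ∀ r q, x r ∈ D q ↔
      ∀ᶠ n in (U : Filter ℕ), (a (2 * i r n), b (2 * i q n + 1)) ∈ R := by
    intro r q
    have h := realize_diag_ultraMk U ρ ![fun n => a (2 * i r n), fun n => b (2 * i q n + 1)]
    have e : (fun c => ultraMk U (![fun n => a (2 * i r n), fun n => b (2 * i q n + 1)] c)) =
        ![x r, y q] := by
      funext c
      fin_cases c <;> rfl
    rw [e] at h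
    refine h.trans (Filter.eventually_congr (Filter.Eventually.of_forall fun n => ?_))
    rw [← hρ']
    refine iff_of_eq (congrArg ρ.Realize ?_)
    funext c
    rcases c with c | c
    · rfl
    · fin_cases c <;> rfl
  have hlt : ∀ (r : ℝ) (q : ℚ), r < q → x r ∈ D q := by
    intro r q h
    -- the indices of `a` are even and those of `b` odd, so that they are never equal
    refine (hmem r q).2 (Filter.Eventually.of_forall fun n => h₁ _ _ ?_)
    have : i r n ≤ i q n := Nat.floor_mono (by gcongr)
    omega
  have hgt : ∀ (r : ℝ) (q : ℚ), (q : ℝ) < r → x r ∉ D q := by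
    intro r q h hx
    have hpos : 0 < Real.exp r - Real.exp q := sub_pos.2 (Real.exp_lt_exp.2 h)
    obtain ⟨n₀, hn₀⟩ := exists_nat_gt (1 / (Real.exp r - Real.exp q))
    have hev : ∀ᶠ n in (U : Filter ℕ), n₀ ≤ n :=
      Nat.hyperfilter_le_atTop (Filter.eventually_ge_atTop n₀)
    obtain ⟨n, hn, hn'⟩ := (((hmem r q).1 hx).and hev).exists
    refine h₂ _ _ ?_ hn
    have h1 : 1 ≤ (Real.exp r - Real.exp q) * n := by
      rw [div_lt_iff₀ hpos] at hn₀
      have : (n₀ : ℝ) ≤ n := Nat.cast_le.2 hn'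
      nlinarith
    have h2 : i q n + 1 ≤ i r n := by
      have h3 : (0 : ℝ) ≤ Real.exp q * n := by positivity
      calc i q n + 1 = ⌊Real.exp q * n + 1⌋₊ := (Nat.floor_add_one h3).symm
        _ ≤ i r n := Nat.floor_mono (by linarith)
    omega
  have hsep : ∀ r r', r < r' → ∃ q, ¬(x r ∈ D q ↔ x r' ∈ D q) := by
    intro r r' h
    obtain ⟨q, h1, h2⟩ := exists_rat_btwn h
    exact ⟨q, fun H => hgt r' q h2 (H.1 (hlt r q h1))⟩
  refine hs.not_separated (N := Ultrapower U N) (model_of_elementaryEmbedding j hN) x D hD ?_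
  intro r r' h
  rcases lt_or_gt_of_ne h with h | h
  · exact hsep r r' h
  · obtain ⟨q, hq⟩ := hsep r' r h
    exact ⟨q, fun H => hq H.symm⟩

end Stable

end ModelTheory

/-! ### Existence of rank and degree in ω-stable structures -/

namespace ModelTheory

open FirstOrder FirstOrder.Language Filter

section Chain

variable {L : FirstOrder.Language.{u, v}}

/-- Dependent choice along elementary embeddings: structures `N` carrying data in `S N`, with a
step that produces an elementary extension and new data there. -/
theorem exists_chain {S : ∀ (N : Type x) [L.Structure N], Type y}
    (P : ℕ → ∀ (N : Type x) [L.Structure N], S N → Prop)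
    (R : ℕ → ∀ (N N' : Type x) [L.Structure N] [L.Structure N'], (N ↪ₑ[L] N') → S N → S N' → Prop)
    (step : ∀ (n : ℕ) (N : Type x) [L.Structure N] (s : S N), P n N s →
      ∃ (N' : Type x) (_ : L.Structure N') (j : N ↪ₑ[L] N') (s' : S N'),
        P (n + 1) N' s' ∧ R n N N' j s s')
    {N₀ : Type x} [L.Structure N₀] (s₀ : S N₀) (h₀ : P 0 N₀ s₀) :
    ∃ (N : ℕ → Type x) (_ : ∀ n, L.Structure (N n)) (j : ∀ n, N n ↪ₑ[L] N (n + 1))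
      (s : ∀ n, S (N n)), (∀ n, P n (N n) (s n)) ∧ ∀ n, R n _ _ (j n) (s n) (s (n + 1)) := by
  let T : ℕ → Type _ := fun n =>
    {p : Σ (N : Type x) (_ : L.Structure N), S N // @P n p.1 p.2.1 p.2.2}
  have hstep : ∀ n (p : T n), ∃ (q : T (n + 1)) (j : letI := p.1.2.1; letI := q.1.2.1;
      p.1.1 ↪ₑ[L] q.1.1), @R n _ _ p.1.2.1 q.1.2.1 j p.1.2.2 q.1.2.2 := by
    rintro n ⟨⟨N, i, s⟩, h⟩
    obtain ⟨N', i', j, s', h', hR⟩ := step n N s h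
    exact ⟨⟨⟨N', i', s'⟩, h'⟩, j, hR⟩
  choose next j hj using hstep
  let t : ∀ n, T n := fun n => Nat.rec ⟨⟨N₀, inferInstance, s₀⟩, h₀⟩ next n
  exact ⟨fun n => (t n).1.1, fun n => (t n).1.2.1, fun n => j n (t n), fun n => (t n).1.2.2,
    fun n => (t n).2, fun n => hj n (t n)⟩

end Chain

section Bound

variable {L : FirstOrder.Language.{u, v}}

/-- A formula with parameters and its parameters up to elementary equivalence: a formula in
finitely many parameter variables and one further variable, and the complete type of the
parameters. -/
abbrev FormulaCode (L : FirstOrder.Language.{u, v}) : Type (max u v) :=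
  Σ n : ℕ, L.Formula (Fin n ⊕ Unit) × Set (L.Formula (Fin n))

/-- The code `c` represents the formula `ψ`, for a suitable choice of the tuple of parameters. -/
def HasCode {N : Type*} [L.Structure N] (ψ : L.Formula (N ⊕ Unit)) (c : FormulaCode L) : Prop :=
  ∃ a : Fin c.1 → N, solutionSet (c.2.1.relabel (Sum.map a id)) = solutionSet ψ ∧
    c.2.2 = {θ | θ.Realize a}

theorem exists_hasCode {N : Type*} [L.Structure N] (ψ : L.Formula (N ⊕ Unit)) :
    ∃ c, HasCode ψ c := by
  classical
  let s := ψ.freeVarFinset.toLeft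
  let e := s.equivFin
  let a : Fin s.card → N := fun i => e.symm i
  let χ : L.Formula (Fin s.card ⊕ Unit) := ψ.restrictFreeVar fun x => Sum.casesOn x.1
    (fun y hy => Sum.inl (e ⟨y, by simpa [s] using hy⟩)) (fun y _ => Sum.inr y) x.2
  refine ⟨⟨s.card, χ, {θ | θ.Realize a}⟩, a, ?_, rfl⟩
  ext x
  simp only [solutionSet, Set.mem_ofPred_eq, Formula.realize_relabel, Sum.elim_comp_map]
  refine BoundedFormula.realize_restrictFreeVar (Sum.elim id fun _ => x) ?_
  rintro ⟨y | y, hy⟩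
  · simp [a]
  · rfl

/-- The rank of a formula depends only on its code: tuples of the same type are identified in a
common elementary extension. -/
theorem FormulaRankGE.of_hasCode {α : Ordinal.{max u v w}} {N N' : Type (max u v w)}
    [L.Structure N] [L.Structure N'] {ψ : L.Formula (N ⊕ Unit)} {ψ' : L.Formula (N' ⊕ Unit)}
    {c : FormulaCode L} (hc : HasCode ψ c) (hc' : HasCode ψ' c)
    (h : FormulaRankGE.{u, v, w} L α N ψ) : FormulaRankGE.{u, v, w} L α N' ψ' := by
  have : Nonempty N := ⟨h.nonempty.some⟩
  obtain ⟨a, ha, ht⟩ := hc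
  obtain ⟨a', ha', ht'⟩ := hc'
  obtain ⟨U, k, hk⟩ := exists_embedding_ultrapower (L := L) a a' fun φ hφ => by
    have h1 : φ ∈ c.2.2 := by rw [ht']; exact hφ
    rw [ht] at h1
    exact h1
  have h1 : FormulaRankGE.{u, v, w} L α N (c.2.1.relabel (Sum.map a id)) := h.mono ha.ge
  have h2 := h1.transport α (diag L U N)
  refine FormulaRankGE.mono (.of_transport k (h2.mono ?_)) ha'.le
  intro x hx
  rw [mem_solutionSet_transport, Formula.realize_relabel, Sum.elim_comp_map] at hx ⊢
  have : (k ∘ a' : Fin c.1 → _) = diag L U N ∘ a := funext hk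
  rw [this]
  exact hx

/-- There are few codes, so the ranks that are not `∞` are bounded. -/
theorem exists_rank_bound (L : FirstOrder.Language.{u, v}) :
    ∃ γ : Ordinal.{max u v w}, ∀ (N : Type (max u v w)) [L.Structure N] (ψ : L.Formula (N ⊕ Unit)),
      FormulaRankGE.{u, v, w} L γ N ψ → ∀ α, FormulaRankGE.{u, v, w} L α N ψ := by
  classical
  let Q : FormulaCode L → Ordinal.{max u v w} → Prop := fun c α =>
    ∃ (N : Type (max u v w)) (_ : L.Structure N) (ψ : L.Formula (N ⊕ Unit)),
      HasCode ψ c ∧ ¬FormulaRankGE.{u, v, w} L α N ψ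
  let b : ULift.{w} (FormulaCode L) → Ordinal.{max u v w} := fun c =>
    if h : ∃ α, Q c.down α then h.choose else 0
  refine ⟨⨆ c, b c, fun N _ ψ hψ α => ?_⟩
  by_contra hα
  obtain ⟨c, hc⟩ := exists_hasCode ψ
  have hQ : ∃ α, Q c α := ⟨α, N, inferInstance, ψ, hc, hα⟩
  obtain ⟨N', _, ψ', hc', hn⟩ := hQ.choose_spec
  have hb : b ⟨c⟩ = hQ.choose := dif_pos hQ
  refine hn (.of_hasCode hc hc' (hψ.of_le ?_))
  rw [← hb]
  exact Ordinal.le_iSup b ⟨c⟩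

/-- A family of formulas of rank `∞` can be split, in a common elementary extension, into pairs of
disjoint formulas of rank `∞`. -/
theorem exists_split {N : Type (max u v w)} [L.Structure N] {ι : Type*} (S : Finset ι)
    (φ : ι → L.Formula (N ⊕ Unit)) (hφ : ∀ s ∈ S, ∀ α, FormulaRankGE.{u, v, w} L α N (φ s)) :
    ∃ (N' : Type (max u v w)) (_ : L.Structure N') (j : N ↪ₑ[L] N')
      (ψ : Bool → ι → L.Formula (N' ⊕ Unit)),
      ∀ s ∈ S, (∀ b, solutionSet (ψ b s) ⊆ solutionSet (transport j (φ s))) ∧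
        Disjoint (solutionSet (ψ true s)) (solutionSet (ψ false s)) ∧
        ∀ b α, FormulaRankGE.{u, v, w} L α N' (ψ b s) := by
  classical
  induction S using Finset.induction_on with
  | empty => exact ⟨N, inferInstance, ElementaryEmbedding.refl L N, fun _ _ => ⊥, by simp⟩
  | insert a S _ ih =>
    obtain ⟨N₁, _, j₁, ψ₁, h₁⟩ := ih fun s hs => hφ s (Finset.mem_insert_of_mem hs)
    -- beyond `γ` all ranks are `∞`, so a family that witnesses rank `γ + 1` has members of rank `∞`
    obtain ⟨γ, hγ⟩ := exists_rank_bound.{u, v, w} L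
    have ha := (hφ a (Finset.mem_insert_self a S) (Order.succ γ)).transport _ j₁
    obtain ⟨N₂, _, j₂, χ, h2, h3, h4⟩ := (formulaRankGE_iff.1 ha).2 γ (Order.lt_succ γ)
    have hcomp : ∀ θ : L.Formula (N ⊕ Unit), solutionSet (transport j₂ (transport j₁ θ)) =
        solutionSet (transport (j₂.comp j₁) θ) :=
      solutionSet_transport_comp j₁ j₂ (j₂.comp j₁) fun _ => rfl
    refine ⟨N₂, inferInstance, j₂.comp j₁,
      fun b s => if s = a then χ (cond b 0 1) else transport j₂ (ψ₁ b s), fun s hs => ?_⟩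
    by_cases hsa : s = a
    · subst hsa
      simp only [if_true]
      refine ⟨fun b => ?_, ?_, fun b => hγ _ _ (h4 _)⟩
      · rw [← hcomp]
        exact h2 _
      · exact h3 zero_ne_one
    · simp only [if_neg hsa]
      obtain ⟨h5, h6, h7⟩ := h₁ s ((Finset.mem_insert.1 hs).resolve_left hsa)
      refine ⟨fun b => ?_, (solutionSet_transport_disjoint j₂).2 h6,
        fun b α => (h7 b α).transport _ j₂⟩
      rw [← hcomp]
      exact (solutionSet_transport_subset j₂).2 (h5 b)

end Bound

section TotallyTranscendental

variable {L : FirstOrder.Language.{u, v}} {B : Type w} [L.Structure B]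
  {N : Type (max u v w)} [L.Structure N]

/-- In an `ω`-stable theory all ranks are ordinals: a formula of rank `∞` would be the root of a
binary tree of formulas. -/
theorem OmegaStable.exists_not_formulaRankGE (hs : OmegaStable.{u, v, w} L B)
    (hN : N ⊨ L.completeTheory B) (φ : L.Formula (N ⊕ Unit)) :
    ∃ α, ¬FormulaRankGE.{u, v, w} L α N φ := by
  by_contra! hφ
  obtain ⟨N, _, j, s, hP, hR⟩ := exists_chain (L := L)
    (S := fun N _ => List Bool → L.Formula (N ⊕ Unit))
    (P := fun n N _ s => N ⊨ L.completeTheory B ∧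
      ∀ l, l.length = n → ∀ α, FormulaRankGE.{u, v, w} L α N (s l))
    (R := fun n N N' _ _ j s s' => ∀ l, l.length = n →
        (∀ b, solutionSet (s' (b :: l)) ⊆ solutionSet (transport j (s l))) ∧
        Disjoint (solutionSet (s' (true :: l))) (solutionSet (s' (false :: l))))
    (fun n N _ s h => by
      let S : Finset (List Bool) := (List.finite_length_eq Bool n).toFinset
      have hS : ∀ l, l ∈ S ↔ l.length = n := fun l => by simp [S]
      obtain ⟨N', _, j, ψ, hψ⟩ := exists_split S s fun l hl => h.2 l ((hS l).1 hl)
      refine ⟨N', inferInstance, j, fun l => ψ (l.headD true) l.tail,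
        ⟨model_of_elementaryEmbedding j h.1, fun l hl => ?_⟩, fun l hl => ?_⟩
      · have : l.tail ∈ S := (hS _).2 (by simp [hl])
        exact (hψ _ this).2.2 _
      · exact ⟨(hψ l ((hS l).2 hl)).1, (hψ l ((hS l).2 hl)).2.1⟩)
    (fun _ => φ) ⟨hN, fun _ _ => hφ⟩
  have : ∀ n, Nonempty (N n) := fun n =>
    ⟨((hP n).2 (List.replicate n true) List.length_replicate 0).nonempty.some⟩
  obtain ⟨M, _, k, hk⟩ := exists_chain_bound j
  have hcomp : ∀ n (θ : L.Formula (N n ⊕ Unit)),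
      solutionSet (transport (k (n + 1)) (transport (j n) θ)) = solutionSet (transport (k n) θ) :=
    fun n => solutionSet_transport_comp (j n) (k (n + 1)) (k n) (hk n)
  refine hs.not_tree (model_of_elementaryEmbedding (k 0) (hP 0).1)
    (fun l => transport (k l.length) (s l.length l)) (fun l => ?_) (fun b l => ?_) fun l => ?_
  · exact (solutionSet_transport_nonempty _).2 ((hP _).2 l rfl 0).nonempty
  · refine Set.Subset.trans ?_ (hcomp l.length (s l.length l)).le
    exact (solutionSet_transport_subset (k (l.length + 1))).2 ((hR _ l rfl).1 b)
  · exact (solutionSet_transport_disjoint (k (l.length + 1))).2 (hR _ l rfl).2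

/-- A non-empty formula whose rank is not `∞` has a rank: if all ranks below a limit ordinal are
reached, so is the limit, and the least rank not reached is a successor. -/
theorem exists_rank_of_not_formulaRankGE {φ : L.Formula (N ⊕ Unit)}
    (hφ : (solutionSet φ).Nonempty) {α : Ordinal.{max u v w}}
    (hα : ¬FormulaRankGE.{u, v, w} L α N φ) :
    ∃ β < α, FormulaRankGE.{u, v, w} L β N φ ∧
      ¬FormulaRankGE.{u, v, w} L (Order.succ β) N φ := by
  by_contra! h
  have hall : ∀ β ≤ α, FormulaRankGE.{u, v, w} L β N φ := by
    intro β
    induction β using WellFoundedLT.induction with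
    | _ β ih =>
      intro hβ
      refine formulaRankGE_iff.2 ⟨hφ, fun γ hγ => ?_⟩
      exact (formulaRankGE_iff.1 (h γ (hγ.trans_le hβ) (ih γ hγ (hγ.le.trans hβ)))).2 γ
        (Order.lt_succ γ)
  exact hα (hall α le_rfl)

end TotallyTranscendental

section Degree

variable {L : FirstOrder.Language.{u, v}} {α : Ordinal.{max u v w}}

/-- `d` pairwise disjoint subsets of the set defined by `φ`, of rank at least `α`, are definable in
some elementary extension. -/
def HasDisjointFamily (L : FirstOrder.Language.{u, v}) (α : Ordinal.{max u v w})
    (N : Type (max u v w)) [L.Structure N] (φ : L.Formula (N ⊕ Unit)) (d : ℕ) : Prop :=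
  ∃ (N' : Type (max u v w)) (_ : L.Structure N') (j : N ↪ₑ[L] N')
    (ψ : Fin d → L.Formula (N' ⊕ Unit)),
    (∀ i, solutionSet (ψ i) ⊆ solutionSet (transport j φ)) ∧
    (Pairwise fun i k => Disjoint (solutionSet (ψ i)) (solutionSet (ψ k))) ∧
    ∀ i, FormulaRankGE.{u, v, w} L α N' (ψ i)

/-- If the families of disjoint subsets of rank at least `α` are unboundedly large, one such subset
can be split off so that the families in the rest are still unboundedly large. -/
theorem exists_split_of_forall_hasDisjointFamily {N : Type (max u v w)} [L.Structure N]
    {φ : L.Formula (N ⊕ Unit)} (h : ∀ d, HasDisjointFamily.{u, v, w} L α N φ d) :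
    ∃ (N' : Type (max u v w)) (_ : L.Structure N') (j : N ↪ₑ[L] N')
      (ψ χ : L.Formula (N' ⊕ Unit)),
      solutionSet ψ ⊆ solutionSet (transport j φ) ∧ solutionSet χ ⊆ solutionSet (transport j φ) ∧
      Disjoint (solutionSet ψ) (solutionSet χ) ∧ FormulaRankGE.{u, v, w} L α N' χ ∧
      ∀ d, HasDisjointFamily.{u, v, w} L α N' ψ d := by
  classical
  obtain ⟨N', _, j, θ, h1, h2, h3⟩ := h 2
  let A := θ 0
  let C := transport j φ ⊓ ∼(θ 0)
  have hC : solutionSet C = solutionSet (transport j φ) \ solutionSet A := by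
    rw [solutionSet_inf, solutionSet_not]
    rfl
  have hCrank : FormulaRankGE.{u, v, w} L α N' C := by
    refine (h3 1).mono ?_
    rw [hC]
    exact Set.subset_sdiff.2 ⟨h1 1, h2 (by decide)⟩
  have hAC : Disjoint (solutionSet A) (solutionSet C) := by
    rw [hC]
    exact Set.disjoint_sdiff_right
  have hCsub : solutionSet C ⊆ solutionSet (transport j φ) := by
    rw [hC]
    exact Set.sdiff_subset
  by_cases hA : ∀ d, HasDisjointFamily.{u, v, w} L α N' A d
  · exact ⟨N', inferInstance, j, A, C, h1 0, hCsub, hAC, hCrank, hA⟩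
  by_cases hC' : ∀ d, HasDisjointFamily.{u, v, w} L α N' C d
  · exact ⟨N', inferInstance, j, C, A, hCsub, h1 0, hAC.symm, h3 0, hC'⟩
  exfalso
  push Not at hA hC'
  obtain ⟨a, ha⟩ := hA
  obtain ⟨c, hc⟩ := hC'
  obtain ⟨N₁, _, j₁, χ, h4, h5, h6⟩ := h (a + c)
  have : Nonempty N' := ⟨hCrank.nonempty.some⟩
  obtain ⟨U, k, hk⟩ := exists_amalgam j j₁
  let i := diag L U N'
  have hφ : solutionSet (transport k (transport j₁ φ)) =
      solutionSet (transport i (transport j φ)) :=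
    solutionSet_transport_transport j₁ k j i hk φ
  have hsub : ∀ m, solutionSet (transport k (χ m)) ⊆
      solutionSet (transport i A) ∪ solutionSet (transport i C) := by
    intro m x hx
    have hx' := hφ.le ((solutionSet_transport_subset k).2 (h4 m) hx)
    have := solutionSet_transport_congr i (φ := transport j φ) (ψ := A ⊔ C) (by
      rw [solutionSet_sup, hC, Set.union_sdiff_cancel (h1 0)])
    rw [this, solutionSet_transport_sup] at hx'
    exact hx'
  have hor : ∀ m, FormulaRankGE.{u, v, w} L α _ (transport k (χ m) ⊓ transport i A) ∨
      FormulaRankGE.{u, v, w} L α _ (transport k (χ m) ⊓ transport i C) := by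
    intro m
    refine FormulaRankGE.or_of_sup α (((h6 m).transport α k).mono ?_)
    rw [solutionSet_sup, solutionSet_inf, solutionSet_inf, ← Set.inter_union_distrib_left]
    exact Set.subset_inter subset_rfl (hsub m)
  have hfam : ∀ (D : L.Formula (N' ⊕ Unit)) (d : ℕ),
      d ≤ (Finset.univ.filter fun m =>
        FormulaRankGE.{u, v, w} L α _ (transport k (χ m) ⊓ transport i D)).card →
      HasDisjointFamily.{u, v, w} L α N' D d := by
    intro D d hd
    obtain ⟨T, hT, hTd⟩ := Finset.exists_subset_card_eq hd
    let e : Fin d ≃ T := (T.equivFinOfCardEq hTd).symm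
    refine ⟨_, inferInstance, i, fun n => transport k (χ (e n)) ⊓ transport i D, fun n => ?_,
      fun n m hnm => ?_, fun n => (Finset.mem_filter.1 (hT (e n).2)).2⟩
    · rw [solutionSet_inf]
      exact Set.inter_subset_right
    · have hne : (e n : Fin (a + c)) ≠ e m := fun H => hnm (e.injective (Subtype.ext H))
      simp only [solutionSet_inf]
      exact ((solutionSet_transport_disjoint k).2 (h5 hne)).mono Set.inter_subset_left
        Set.inter_subset_left
  have h7 := not_le.1 fun hle => ha (hfam A a hle)
  have h8 := not_le.1 fun hle => hc (hfam C c hle)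
  have h9 : (Finset.univ : Finset (Fin (a + c))) ⊆
      (Finset.univ.filter fun m =>
        FormulaRankGE.{u, v, w} L α _ (transport k (χ m) ⊓ transport i A)) ∪
      (Finset.univ.filter fun m =>
        FormulaRankGE.{u, v, w} L α _ (transport k (χ m) ⊓ transport i C)) := by
    intro m _
    rw [Finset.mem_union, Finset.mem_filter, Finset.mem_filter]
    exact (hor m).imp (fun h => ⟨Finset.mem_univ m, h⟩) fun h => ⟨Finset.mem_univ m, h⟩
  have h10 := (Finset.card_le_card h9).trans (Finset.card_union_le _ _)
  rw [Finset.card_univ, Fintype.card_fin] at h10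
  omega

/-- Unboundedly large families of disjoint subsets of rank at least `α` give an infinite one. -/
theorem formulaRankGE_succ_of_forall_hasDisjointFamily {N₀ : Type (max u v w)} [L.Structure N₀]
    {φ : L.Formula (N₀ ⊕ Unit)} (h : ∀ d, HasDisjointFamily.{u, v, w} L α N₀ φ d) :
    FormulaRankGE.{u, v, w} L (Order.succ α) N₀ φ := by
  have hne : (solutionSet φ).Nonempty := by
    obtain ⟨N', _, j, θ, h1, h2, h3⟩ := h 1
    exact (solutionSet_transport_nonempty j).1 ((h3 0).nonempty.mono (h1 0))
  obtain ⟨N, _, j, s, hP, hR⟩ := exists_chain (L := L)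
    (S := fun N _ => L.Formula (N ⊕ Unit) × L.Formula (N ⊕ Unit))
    (P := fun n N _ s => (∀ d, HasDisjointFamily.{u, v, w} L α N s.1 d) ∧
      ∃ i : N₀ ↪ₑ[L] N, solutionSet s.1 ⊆ solutionSet (transport i φ))
    (R := fun n N N' _ _ j s s' => solutionSet s'.1 ⊆ solutionSet (transport j s.1) ∧
      solutionSet s'.2 ⊆ solutionSet (transport j s.1) ∧
      Disjoint (solutionSet s'.1) (solutionSet s'.2) ∧ FormulaRankGE.{u, v, w} L α N' s'.2)
    (fun n N _ s hP => by
      obtain ⟨N', _, j, ψ, χ, h1, h2, h3, h4, h5⟩ :=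
        exists_split_of_forall_hasDisjointFamily hP.1
      obtain ⟨i, hi⟩ := hP.2
      refine ⟨N', inferInstance, j, (ψ, χ), ⟨h5, j.comp i, h1.trans ?_⟩, h1, h2, h3, h4⟩
      rw [← solutionSet_transport_comp i j (j.comp i) fun _ => rfl]
      exact (solutionSet_transport_subset j).2 hi)
    (φ, ⊥) ⟨h, ElementaryEmbedding.refl L N₀, fun x hx => by
      rw [mem_solutionSet_transport]
      exact hx⟩
  have : ∀ n, Nonempty (N n) := fun n => by
    obtain ⟨i, -⟩ := (hP n).2
    exact ⟨i hne.some⟩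
  obtain ⟨M, _, k, hk⟩ := exists_chain_bound j
  have hcomp : ∀ n (θ : L.Formula (N n ⊕ Unit)),
      solutionSet (transport (k (n + 1)) (transport (j n) θ)) = solutionSet (transport (k n) θ) :=
    fun n => solutionSet_transport_comp (j n) (k (n + 1)) (k n) (hk n)
  have hanti : ∀ m n, m ≤ n → solutionSet (transport (k n) (s n).1) ⊆
      solutionSet (transport (k m) (s m).1) := by
    intro m n h
    induction n, h using Nat.le_induction with
    | base => exact subset_rfl
    | succ n _ ih =>
      refine Set.Subset.trans (Set.Subset.trans ?_ (hcomp n (s n).1).le) ih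
      exact (solutionSet_transport_subset (k (n + 1))).2 (hR n).1
  have hsnd : ∀ n, solutionSet (transport (k (n + 1)) (s (n + 1)).2) ⊆
      solutionSet (transport (k n) (s n).1) := by
    intro n
    refine Set.Subset.trans ?_ (hcomp n (s n).1).le
    exact (solutionSet_transport_subset (k (n + 1))).2 (hR n).2.1
  have hdisj : ∀ m n, m < n → Disjoint (solutionSet (transport (k (m + 1)) (s (m + 1)).2))
      (solutionSet (transport (k (n + 1)) (s (n + 1)).2)) := by
    intro m n hmn
    exact ((solutionSet_transport_disjoint (k (m + 1))).2 (hR m).2.2.1).symm.mono_right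
      ((hsnd n).trans (hanti (m + 1) n hmn))
  obtain ⟨i, hi⟩ := (hP 0).2
  refine formulaRankGE_iff.2 ⟨hne, fun β hβ => ⟨M, inferInstance, (k 0).comp i,
    fun n => transport (k (n + 1)) (s (n + 1)).2, fun n => ?_, fun m n hmn => ?_, fun n =>
      (((hR n).2.2.2).of_le (Order.lt_succ_iff.1 hβ)).transport _ _⟩⟩
  · refine (hsnd n).trans ((hanti 0 n n.zero_le).trans ?_)
    rw [← solutionSet_transport_comp i (k 0) ((k 0).comp i) fun _ => rfl]
    exact (solutionSet_transport_subset _).2 hi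
  · rcases lt_or_gt_of_ne hmn with h | h
    · exact hdisj m n h
    · exact (hdisj n m h).symm

end Degree

end ModelTheory

/-! ### Algebra and definability in K-loops -/

namespace KLoop

section Algebra

variable {B : Type*} [KLoop B]

theorem add_left_inj' {a x y : B} : a + x = a + y ↔ x = y :=
  ⟨fun h => (existsUnique_right a (a + y)).unique h rfl, fun h => h ▸ rfl⟩

theorem add_right_inj' {a x y : B} : x + a = y + a ↔ x = y :=
  ⟨fun h => (existsUnique_left a (y + a)).unique h rfl, fun h => h ▸ rfl⟩

theorem neg_add_self (a : B) : -a + a = 0 := by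
  obtain ⟨x, hx, -⟩ := existsUnique_left a (0 : B)
  -- the left inverse `x` of `a` satisfies `x + (a + x) = x`, hence is a right inverse
  have h1 := bol x a a
  simp only [hx, add_zero'] at h1
  have h2 : x + (a + x) = x := add_right_inj'.1 (h1.symm.trans hx.symm)
  have h3 : a + x = 0 := add_left_inj'.1 (h2.trans (add_zero' x).symm)
  have h4 : x = -a := add_left_inj'.1 (h3.trans (add_neg' a).symm)
  rw [← h4, hx]

theorem add_neg_cancel_left' (a b : B) : a + (-a + b) = b := by
  obtain ⟨c, rfl, -⟩ := existsUnique_right a b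
  have h := bol a (-a) c
  rwa [neg_add_self, add_zero'] at h

theorem neg_add_cancel_left' (a b : B) : -a + (a + b) = b :=
  add_left_inj'.1 (add_neg_cancel_left' a (a + b))

theorem add_self_add (a b : B) : (a + a) + b = a + (a + b) := by
  have h := bol a 0 b
  rwa [zero_add', zero_add', eq_comm] at h

/-- The automorphic inverse property turns the double of a sum into a quadratic expression. -/
theorem add_add_self (a b : B) : (a + b) + (a + b) = a + ((b + b) + a) := by
  -- both sides become `a + b` when `-(a + b)` is added on the right
  refine (add_right_inj' (a := -(a + b))).1 ?_
  rw [add_self_add, add_neg', add_zero', neg_add', ← bol, add_neg_cancel_left', add_self_add,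
    add_neg', add_zero']

theorem rightDiv_add (a b : B) : (-a + ((a + b) + -a)) + a = b := by
  rw [← bol, neg_add_self, add_zero', neg_add_cancel_left']

/-- The quadratic map `x ↦ a + (x + a)`. -/
def quad (a x : B) : B := a + (x + a)

theorem quad_add (a b c : B) : quad a b + c = a + (b + (a + c)) := (bol a b c).symm

theorem quad_neg_quad (a x : B) : quad (-a) (quad a x) = x := by
  rw [← add_zero' (quad (-a) (quad a x)), quad_add, add_zero', quad_add, add_neg',
    add_zero', neg_add_cancel_left']

theorem neg_neg' (a : B) : - -a = a :=
  add_left_inj'.1 ((add_neg' (-a)).trans (neg_add_self a).symm)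

theorem quad_quad_neg (a x : B) : quad a (quad (-a) x) = x := by
  have h := quad_neg_quad (-a) x
  rwa [neg_neg'] at h

theorem IsSubloop.neg_mem {C : Set B} (hC : IsSubloop C) {a : B} (ha : a ∈ C) : -a ∈ C := by
  obtain ⟨y, hy, h⟩ := hC.exists_right a ha 0 hC.zero_mem
  rwa [← add_left_inj'.1 (h.trans (add_neg' a).symm)]

theorem IsSubloop.isConvexSubset {C : Set B} (hC : IsSubloop C) : IsConvexSubset C :=
  fun _ hx _ hy => hC.add_mem _ hy _ (hC.add_mem _ (hC.neg_mem hx) _ hy)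

theorem IsSubloop.of_neg_mem {C : Set B} (h0 : (0 : B) ∈ C) (hadd : ∀ a ∈ C, ∀ b ∈ C, a + b ∈ C)
    (hneg : ∀ a ∈ C, -a ∈ C) : IsSubloop C :=
  ⟨h0, hadd,
    fun a ha b hb =>
      ⟨_, hadd _ (hneg a ha) _ (hadd _ (hadd a ha b hb) _ (hneg a ha)), rightDiv_add a b⟩,
    fun a ha b hb => ⟨_, hadd _ (hneg a ha) b hb, add_neg_cancel_left' a b⟩⟩

theorem isSubloop_univ : IsSubloop (Set.univ : Set B) :=
  .of_neg_mem trivial (fun _ _ _ _ => trivial) fun _ _ => trivial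

/-- The quadratic maps are automorphisms for the symétron operation. -/
theorem quad_symm (e x y : B) : quad e (symm x y) = symm (quad e x) (quad e y) := by
  have hneg : -quad e x = quad (-e) (-x) := by
    rw [quad, quad, neg_add', neg_add']
  rw [symm, symm, hneg, quad_add e y, quad_add (-e), add_neg_cancel_left', quad, quad,
    neg_add_cancel_left', bol y]

/-- Each point `y` is the image of each point `v` under exactly one symmetry, whose centre is in
any subloop that contains `y` and `v` and is closed under halving. The double of `w + -(v / 2)` is
`s_w(v)`, so the centre is obtained by solving `w + -(v / 2) = y / 2`. -/
theorem exists_symm_eq (hdiv : UniquelyTwoDivisible B) {K : Set B} (hK : IsSubloop K)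
    (hhalf : ∀ x, x + x ∈ K → x ∈ K) (y : B) (hy : y ∈ K) (v : B) (hv : v ∈ K) :
    ∃ w ∈ K, symm v w = y := by
  obtain ⟨v', rfl⟩ := hdiv.2 v
  obtain ⟨y', rfl⟩ := hdiv.2 y
  obtain ⟨w, hw, h⟩ := hK.exists_left (-v') (hK.neg_mem (hhalf _ hv)) y' (hhalf _ hy)
  refine ⟨w, hw, ?_⟩
  dsimp only
  rw [symm, neg_add', ← add_add_self, h]

theorem symm_right_injective (hdiv : UniquelyTwoDivisible B) (v : B) :
    Function.Injective (symm v) := by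
  obtain ⟨v', rfl⟩ := hdiv.2 v
  intro w w' h
  dsimp only at h
  rw [symm, symm, neg_add', ← add_add_self, ← add_add_self] at h
  exact add_right_inj'.1 (hdiv.1 h)

theorem symm_left_injective (w : B) : Function.Injective fun v => symm v w := by
  intro v v' h
  have := add_right_inj'.1 (add_left_inj'.1 h)
  rw [← neg_neg' v, this, neg_neg']

end Algebra

section Definable

open Set

theorem definableFun_const {L : FirstOrder.Language.{u, v}} {B : Type*} [L.Structure B]
    {α : Type*} (a : B) : (univ : Set B).DefinableFun L fun _ : α → B => a :=
  FirstOrder.Language.definableFun_const L α (mem_univ a)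

theorem _root_.Set.DefinableFun.preimage_definable₁ {L : FirstOrder.Language.{u, v}} {B : Type*}
    [L.Structure B] {α : Type*} {f : (α → B) → B} {X : Set B}
    (hf : (univ : Set B).DefinableFun L f) (hX : (univ : Set B).Definable₁ L X) :
    (univ : Set B).Definable L {x | f x ∈ X} :=
  Set.Definable.preimage_map (F := fun x (_ : Fin 1) => f x) (fun _ => hf) hX

variable {L : FirstOrder.Language.{u, v}} {B : Type*} [L.Structure B] [KLoop B] {α : Type*}
  {f g : (α → B) → B}

theorem DefinableLaw.add (h : DefinableLaw L B) (hf : (univ : Set B).DefinableFun L f)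
    (hg : (univ : Set B).DefinableFun L g) :
    (univ : Set B).DefinableFun L fun x => f x + g x := by
  have h1 : (univ : Set B).DefinableFun L fun t : Fin 2 → B => t 0 + t 1 := by
    have h2 := Set.Definable.preimage_comp (![some 0, some 1, none] : Fin 3 → Option (Fin 2)) h
    exact h2
  have h2 : (univ : Set B).DefinableMap L fun x => ![f x, g x] := by
    intro i
    fin_cases i
    · exact hf
    · exact hg
  exact DefinableFun.comp h2 h1

theorem DefinableLaw.neg [Finite α] (h : DefinableLaw L B) (hf : (univ : Set B).DefinableFun L f) :
    (univ : Set B).DefinableFun L fun x => -f x := by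
  have h1 : (univ : Set B).DefinableFun L fun x : Option α → B => f fun a => x (some a) :=
    DefinableFun.comp (fun a => DefinableFun.proj L) hf
  have h2 : (univ : Set B).DefinableFun L fun x : Option α → B => x none := DefinableFun.proj L
  have h3 := (h.add h1 h2).ofPred_eq (definableFun_const (L := L) 0)
  have e : (fun x : α → B => -f x).tupleGraph =
      {x : Option α → B | (f fun a => x (some a)) + x none = 0} := by
    ext x
    change -f (fun a => x (some a)) = x none ↔ _
    rw [Set.mem_ofPred_eq, ← add_neg' (f fun a => x (some a)), add_left_inj', eq_comm]
  rw [DefinableFun, e]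
  exact h3

end Definable

end KLoop

/-! ### Generic types -/

namespace ModelTheory

open FirstOrder FirstOrder.Language Filter Set

/-- Ramsey's theorem for pairs of natural numbers and two colours. -/
theorem exists_strictMono_homogeneous (C : ℕ → ℕ → Prop) :
    ∃ g : ℕ → ℕ, StrictMono g ∧
      ((∀ m n, m < n → C (g m) (g n)) ∨ ∀ m n, m < n → ¬C (g m) (g n)) := by
  let U : Ultrafilter ℕ := Filter.hyperfilter ℕ
  have key : ∀ D : ℕ → ℕ → Prop, (∀ᶠ i in (U : Filter ℕ), ∀ᶠ k in (U : Filter ℕ), D i k) →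
      ∃ g : ℕ → ℕ, StrictMono g ∧ ∀ m n, m < n → D (g m) (g n) := by
    intro D hD
    obtain ⟨g, -, hg⟩ := exists_seq_of_forall_finset_exists
      (fun i => ∀ᶠ k in (U : Filter ℕ), D i k) (fun i k => i < k ∧ D i k) fun s hs => by
        have h1 : ∀ᶠ k in (U : Filter ℕ), ∀ i ∈ s, i < k ∧ D i k :=
          (Filter.eventually_all_finset s).2 fun i hi =>
            Filter.Eventually.and (Nat.hyperfilter_le_atTop (Filter.eventually_gt_atTop i))
              (hs i hi)
        exact (hD.and h1).exists
    exact ⟨g, strictMono_nat_of_lt_succ fun n => (hg n (n + 1) n.lt_succ_self).1,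
      fun m n h => (hg m n h).2⟩
  by_cases h : ∀ᶠ i in (U : Filter ℕ), ∀ᶠ k in (U : Filter ℕ), C i k
  · obtain ⟨g, hg, hC⟩ := key C h
    exact ⟨g, hg, Or.inl hC⟩
  · rw [← Ultrafilter.eventually_not] at h
    obtain ⟨g, hg, hC⟩ := key (fun i k => ¬C i k)
      (h.mono fun i hi => Ultrafilter.eventually_not.2 hi)
    exact ⟨g, hg, Or.inr hC⟩

/-- The properties of the definable sets of maximal Morley rank: they are the complement of an ideal
that is invariant under definable injections, and at most `d` of them are disjoint. -/
structure IsLargeness (L : FirstOrder.Language.{u, v}) {N : Type*} [L.Structure N]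
    (Gen : Set N → Prop) (d : ℕ) : Prop where
  definable : ∀ X, Gen X → (univ : Set N).Definable₁ L X
  nonempty : ∀ X, Gen X → X.Nonempty
  mono : ∀ X Y, Gen X → (univ : Set N).Definable₁ L Y → X ⊆ Y → Gen Y
  union : ∀ X Y, (univ : Set N).Definable₁ L X → (univ : Set N).Definable₁ L Y →
    Gen (X ∪ Y) → Gen X ∨ Gen Y
  gen_univ : Gen univ
  image : ∀ f : N → N, Function.Injective f →
    (Set.univ : Set N).DefinableFun L (fun v : Fin 1 → N => f (v 0)) → ∀ X, Gen X → Gen (f '' X)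
  card_le : ∀ (ι : Type) [Fintype ι] (X : ι → Set N), (∀ i, Gen (X i)) →
    (Pairwise fun i k => Disjoint (X i) (X k)) → Fintype.card ι ≤ d

/-- The properties of the definable sets of maximal Morley rank in a stable structure in which the
Morley degree `d` is attained. -/
structure IsGenericity (L : FirstOrder.Language.{u, v}) {N : Type*} [L.Structure N]
    (Gen : Set N → Prop) (d : ℕ) : Prop extends IsLargeness L Gen d where
  exists_family : ∃ A : Fin d → Set N, (∀ i, Gen (A i)) ∧
    Pairwise fun i k => Disjoint (A i) (A k)
  not_order : ∀ R : Set (N × N), (Set.univ : Set N).Definable₂ L R → ∀ a b : ℕ → N,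
    (∀ m n, m < n → (a m, b n) ∈ R) → (∀ m n, n < m → (a m, b n) ∉ R) → False

/-- A generic type: a complete type over `N`, given as the set of the definable sets in it, that
consists of generic sets. -/
structure IsGenericType (L : FirstOrder.Language.{u, v}) {N : Type*} [L.Structure N]
    (Gen : Set N → Prop) (p : Set (Set N)) : Prop where
  gen : ∀ X ∈ p, Gen X
  inter : ∀ X ∈ p, ∀ Y ∈ p, X ∩ Y ∈ p
  mem_or_compl_mem : ∀ X, (univ : Set N).Definable₁ L X → X ∈ p ∨ Xᶜ ∈ p

section Definable

variable {L : FirstOrder.Language.{u, v}} {N : Type*} [L.Structure N] {X Y : Set N}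

theorem _root_.Set.Definable₁.inter (hX : (univ : Set N).Definable₁ L X)
    (hY : (univ : Set N).Definable₁ L Y) : (univ : Set N).Definable₁ L (X ∩ Y) :=
  Set.Definable.inter hX hY

theorem _root_.Set.Definable₁.union (hX : (univ : Set N).Definable₁ L X)
    (hY : (univ : Set N).Definable₁ L Y) : (univ : Set N).Definable₁ L (X ∪ Y) :=
  Set.Definable.union hX hY

theorem _root_.Set.Definable₁.compl (hX : (univ : Set N).Definable₁ L X) :
    (univ : Set N).Definable₁ L Xᶜ :=
  Set.Definable.compl hX

theorem definable₁_univ : (univ : Set N).Definable₁ L (univ : Set N) :=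
  Set.definable_univ

theorem definable₁_biUnion {ι : Type*} (S : Finset ι) (X : ι → Set N)
    (hX : ∀ i, (univ : Set N).Definable₁ L (X i)) :
    (univ : Set N).Definable₁ L (⋃ i ∈ S, X i) := by
  have h := Set.definable_biUnion_finset hX S
  rw [Set.Definable₁]
  convert h using 1
  ext x
  simp

theorem definable₁_biInter {ι : Type*} (S : Finset ι) (X : ι → Set N)
    (hX : ∀ i, (univ : Set N).Definable₁ L (X i)) :
    (univ : Set N).Definable₁ L (⋂ i ∈ S, X i) := by
  have h := Set.definable_biInter_finset hX S
  rw [Set.Definable₁]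
  convert h using 1
  ext x
  simp

/-- The section of a definable relation at a point is definable. -/
theorem definable₁_section {R : Set (N × N)} (hR : (univ : Set N).Definable₂ L R) (b : N) :
    (univ : Set N).Definable₁ L {a | (a, b) ∈ R} := by
  refine Set.Definable.preimage_map (F := fun (x : Fin 1 → N) => ![x 0, b]) (fun i => ?_) hR
  fin_cases i
  · exact DefinableFun.proj L
  · exact KLoop.definableFun_const b

theorem definable₁_section' {R : Set (N × N)} (hR : (univ : Set N).Definable₂ L R) (a : N) :
    (univ : Set N).Definable₁ L {b | (a, b) ∈ R} := by
  refine Set.Definable.preimage_map (F := fun (x : Fin 1 → N) => ![a, x 0]) (fun i => ?_) hR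
  fin_cases i
  · exact KLoop.definableFun_const a
  · exact DefinableFun.proj L

end Definable

section GenericType

variable {L : FirstOrder.Language.{u, v}} {N : Type*} [L.Structure N] {Gen : Set N → Prop}
  {d : ℕ} {p q : Set (Set N)} {X Y : Set N}

theorem IsLargeness.not_empty (hG : IsLargeness L Gen d) : ¬Gen ∅ := fun h =>
  Set.not_nonempty_empty (hG.nonempty _ h)

theorem IsGenericType.mem_of_subset (hG : IsGenericity L Gen d) (hp : IsGenericType L Gen p)
    (hX : X ∈ p) (hY : (univ : Set N).Definable₁ L Y) (h : X ⊆ Y) : Y ∈ p := by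
  refine (hp.mem_or_compl_mem Y hY).resolve_right fun hc => hG.not_empty ?_
  have h1 := hp.gen _ (hp.inter _ hX _ hc)
  rwa [Set.disjoint_iff_inter_eq_empty.1 (Set.disjoint_compl_right_iff_subset.2 h)] at h1

theorem IsGenericType.univ_mem (hG : IsGenericity L Gen d) (hp : IsGenericType L Gen p) :
    Set.univ ∈ p := by
  rcases hp.mem_or_compl_mem _ definable₁_univ with h | h
  · exact h
  · rw [Set.compl_univ] at h
    exact absurd (hp.gen _ h) hG.not_empty

theorem IsGenericType.compl_notMem (hG : IsGenericity L Gen d) (hp : IsGenericType L Gen p)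
    (hX : X ∈ p) : Xᶜ ∉ p := fun h => hG.not_empty (by
  have := hp.gen _ (hp.inter _ hX _ h)
  rwa [Set.inter_compl_self] at this)

theorem IsGenericType.eq_of_subset (hG : IsGenericity L Gen d) (hp : IsGenericType L Gen p)
    (hq : IsGenericType L Gen q) (h : p ⊆ q) : p = q := by
  refine Set.Subset.antisymm h fun X hX => ?_
  exact (hp.mem_or_compl_mem X (hG.definable _ (hq.gen _ hX))).resolve_right fun hc =>
    hq.compl_notMem hG hX (h hc)

theorem IsGenericType.biInter_mem (hG : IsGenericity L Gen d) (hp : IsGenericType L Gen p)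
    {ι : Type*} (S : Finset ι) (X : ι → Set N) (hX : ∀ i ∈ S, X i ∈ p) : (⋂ i ∈ S, X i) ∈ p := by
  classical
  induction S using Finset.induction_on with
  | empty => simpa using hp.univ_mem hG
  | insert a S _ ih =>
    rw [Finset.set_biInter_insert]
    exact hp.inter _ (hX a (Finset.mem_insert_self a S)) _
      (ih fun i hi => hX i (Finset.mem_insert_of_mem hi))

theorem IsGenericType.exists_mem_of_biUnion_mem (hG : IsGenericity L Gen d)
    (hp : IsGenericType L Gen p) {ι : Type*} (S : Finset ι) (X : ι → Set N)
    (hX : ∀ i, (univ : Set N).Definable₁ L (X i)) (h : (⋃ i ∈ S, X i) ∈ p) : ∃ i ∈ S, X i ∈ p := by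
  by_contra! hn
  have h1 := hp.biInter_mem hG S (fun i => (X i)ᶜ) fun i hi =>
    (hp.mem_or_compl_mem _ (hX i)).resolve_left (hn i hi)
  have h2 : (⋂ i ∈ S, (X i)ᶜ) = (⋃ i ∈ S, X i)ᶜ := by simp
  rw [h2] at h1
  exact hp.compl_notMem hG h h1

theorem IsLargeness.exists_gen_of_biUnion (hG : IsLargeness L Gen d) {ι : Type*} (S : Finset ι)
    (X : ι → Set N) (hX : ∀ i, (univ : Set N).Definable₁ L (X i)) (h : Gen (⋃ i ∈ S, X i)) :
    ∃ i ∈ S, Gen (X i) := by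
  classical
  induction S using Finset.induction_on with
  | empty => exact absurd (by simpa using h) hG.not_empty
  | insert a S _ ih =>
    rw [Finset.set_biUnion_insert] at h
    rcases hG.union _ _ (hX a) (definable₁_biUnion S X hX) h with h | h
    · exact ⟨a, Finset.mem_insert_self a S, h⟩
    · obtain ⟨i, hi, hi'⟩ := ih h
      exact ⟨i, Finset.mem_insert_of_mem hi, hi'⟩

/-- When there are as many disjoint generic sets as possible, none of them contains two disjoint
generic sets. -/
theorem IsLargeness.not_disjoint_of_family (hG : IsLargeness L Gen d) {n : ℕ} (A : Fin n → Set N)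
    (hA : ∀ i, Gen (A i)) (hdisj : Pairwise fun i k => Disjoint (A i) (A k)) (hn : d ≤ n)
    (i : Fin n) (X Y : Set N) (hX : Gen X) (hY : Gen Y) (hXY : Disjoint X Y) (hXA : X ⊆ A i)
    (hYA : Y ⊆ A i) : False := by
  classical
  have h1 := hG.card_le (Option (Fin n))
    (fun k => k.elim X fun k => if k = i then Y else A k) (by
      rintro (_ | k)
      · exact hX
      · change Gen (if k = i then Y else A k)
        split_ifs
        · exact hY
        · exact hA k) (by
      have h2 : ∀ k, (if k = i then Y else A k) ⊆ A k := by
        intro k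
        split_ifs with h
        · rw [h]
          exact hYA
        · exact subset_rfl
      have h3 : ∀ k, Disjoint X (if k = i then Y else A k) := by
        intro k
        split_ifs with h
        · exact hXY
        · exact (hdisj (Ne.symm h)).mono_left hXA
      rintro (_ | k) (_ | l) hkl
      · exact absurd rfl hkl
      · exact h3 l
      · exact (h3 k).symm
      · exact (hdisj fun h => hkl (congrArg some h)).mono (h2 k) (h2 l))
  rw [Fintype.card_option, Fintype.card_fin] at h1
  omega

/-- A maximal family of disjoint generic sets isolates all generic types: each member lies in
exactly one of them, and each generic type contains a member. -/
theorem IsGenericity.exists_isolating (hG : IsGenericity L Gen d) :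
    ∃ (A : Fin d → Set N) (P : Fin d → Set (Set N)), (∀ i, IsGenericType L Gen (P i)) ∧
      (∀ i, A i ∈ P i) ∧ Function.Injective P ∧
      (∀ p, IsGenericType L Gen p → ∃ i, A i ∈ p) ∧
      ∀ i p, IsGenericType L Gen p → A i ∈ p → p = P i := by
  classical
  obtain ⟨A, hA, hdisj⟩ := hG.exists_family
  have hAdef := fun i => hG.definable _ (hA i)
  have hrest : ¬Gen (⋃ i ∈ (Finset.univ : Finset (Fin d)), A i)ᶜ := by
    intro h
    have h1 := hG.card_le (Option (Fin d))
      (fun i => i.elim (⋃ i ∈ (Finset.univ : Finset (Fin d)), A i)ᶜ A) (by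
        rintro (_ | i)
        · exact h
        · exact hA i) (by
        have h2 : ∀ i, Disjoint (A i) (⋃ i ∈ (Finset.univ : Finset (Fin d)), A i)ᶜ := fun i =>
          Set.disjoint_compl_right_iff_subset.2 fun x hx => by
            simp only [Set.mem_iUnion]
            exact ⟨i, Finset.mem_univ i, hx⟩
        rintro (_ | i) (_ | k) hik
        · exact absurd rfl hik
        · exact (h2 k).symm
        · exact h2 i
        · exact hdisj fun h => hik (congrArg some h))
    rw [Fintype.card_option, Fintype.card_fin] at h1
    omega
  have htwo := hG.not_disjoint_of_family A hA hdisj le_rfl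
  let P : Fin d → Set (Set N) := fun i => {X | (univ : Set N).Definable₁ L X ∧ Gen (X ∩ A i)}
  have hP : ∀ i, IsGenericType L Gen (P i) := by
    intro i
    refine ⟨fun X hX => hG.mono _ _ hX.2 hX.1 Set.inter_subset_left,
      fun X hX Y hY => ⟨hX.1.inter hY.1, ?_⟩, fun X hX => ?_⟩
    · have h1 : Gen ((X ∩ Y ∩ A i) ∪ (X ∩ A i ∩ Yᶜ)) :=
        hG.mono _ _ hX.2 (((hX.1.inter hY.1).inter (hAdef i)).union
          ((hX.1.inter (hAdef i)).inter hY.1.compl)) fun x hx => by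
            by_cases hxY : x ∈ Y
            · exact Or.inl ⟨⟨hx.1, hxY⟩, hx.2⟩
            · exact Or.inr ⟨hx, hxY⟩
      refine (hG.union _ _ ((hX.1.inter hY.1).inter (hAdef i))
        ((hX.1.inter (hAdef i)).inter hY.1.compl) h1).resolve_right fun h2 => ?_
      exact htwo i _ _ h2 hY.2 (Set.disjoint_left.2 fun x hx hy => hx.2 hy.1)
        (fun x hx => hx.1.2) Set.inter_subset_right
    · have h1 : Gen ((X ∩ A i) ∪ (Xᶜ ∩ A i)) := by
        rw [← Set.union_inter_distrib_right, Set.union_compl_self, Set.univ_inter]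
        exact hA i
      exact (hG.union _ _ (hX.inter (hAdef i)) (hX.compl.inter (hAdef i)) h1).imp
        (fun h => ⟨hX, h⟩) fun h => ⟨hX.compl, h⟩
  have hAP : ∀ i, A i ∈ P i := fun i => ⟨hAdef i, by rw [Set.inter_self]; exact hA i⟩
  refine ⟨A, P, hP, hAP, fun i k h => ?_, fun p hp => ?_, fun i p hp hi => ?_⟩
  · by_contra hne
    have h1 : A i ∈ P k := h ▸ hAP i
    have h2 := h1.2
    rw [Set.disjoint_iff_inter_eq_empty.1 (hdisj hne)] at h2
    exact hG.not_empty h2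
  · obtain ⟨i, -, hi⟩ := hp.exists_mem_of_biUnion_mem hG Finset.univ A hAdef
      ((hp.mem_or_compl_mem _ (definable₁_biUnion _ A hAdef)).resolve_right fun h =>
        hrest (hp.gen _ h))
    exact ⟨i, hi⟩
  · exact hp.eq_of_subset hG (hP i) fun X hX =>
      ⟨hG.definable _ (hp.gen _ hX), hp.gen _ (hp.inter _ hX _ hi)⟩

/-- Generic types are definable: whether the section of `R` at `b` lies in `p` is decided by the
relations of `b` with finitely many points. Otherwise there are points `aₙ`, `bₙ`, `cₙ` such that
the section at `bₙ`, but not that at `cₙ`, lies in `p`, the points `bₙ` and `cₙ` have the same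
relations with the earlier `aₘ`, and `aₙ` satisfies all that `p` says about the earlier `bₘ` and
`cₘ`; by Ramsey's theorem `R` orders a subsequence. -/
theorem IsGenericType.definable (hG : IsGenericity L Gen d) (hp : IsGenericType L Gen p)
    {R : Set (N × N)} (hR : (univ : Set N).Definable₂ L R) :
    (univ : Set N).Definable₁ L {b | {a | (a, b) ∈ R} ∈ p} := by
  classical
  have hsec := definable₁_section hR
  have claim : ∃ F : Finset N, ∀ b c, (∀ a ∈ F, (a, b) ∈ R ↔ (a, c) ∈ R) →
      {a | (a, b) ∈ R} ∈ p → {a | (a, c) ∈ R} ∈ p := by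
    by_contra! hn
    obtain ⟨t, -, ht⟩ := exists_seq_of_forall_finset_exists
      (fun t : N × N × N => {a | (a, t.2.1) ∈ R} ∈ p ∧ {a | (a, t.2.2) ∈ R} ∉ p)
      (fun t t' => ((t.1, t'.2.1) ∈ R ↔ (t.1, t'.2.2) ∈ R) ∧ (t'.1, t.2.1) ∈ R ∧
        (t'.1, t.2.2) ∉ R) fun s hs => by
        obtain ⟨b, c, h1, h2, h3⟩ := hn (s.image Prod.fst)
        have h4 : (⋂ t ∈ s, {a | (a, t.2.1) ∈ R} ∩ {a | (a, t.2.2) ∈ R}ᶜ) ∈ p :=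
          hp.biInter_mem hG s _ fun t ht => hp.inter _ (hs t ht).1 _
            ((hp.mem_or_compl_mem _ (hsec _)).resolve_left (hs t ht).2)
        obtain ⟨a, ha⟩ := hG.nonempty _ (hp.gen _ h4)
        simp only [Set.mem_iInter] at ha
        exact ⟨(a, b, c), ⟨h2, h3⟩, fun t ht =>
          ⟨h1 _ (Finset.mem_image_of_mem _ ht), (ha t ht).1, (ha t ht).2⟩⟩
    obtain ⟨g, hg, hC⟩ := exists_strictMono_homogeneous fun m n => ((t m).1, (t n).2.1) ∈ R
    rcases hC with hC | hC
    · refine hG.not_order R hR (fun n => (t (g n)).1) (fun n => (t (g n)).2.2)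
        (fun m n h => ?_) fun m n h => ?_
      · exact (ht _ _ (hg h)).1.1 (hC m n h)
      · exact (ht _ _ (hg h)).2.2
    · refine hG.not_order Rᶜ (Set.Definable.compl hR) (fun n => (t (g n)).1)
        (fun n => (t (g n)).2.1) (fun m n h => hC m n h) fun m n h => ?_
      exact fun hc => hc (ht _ _ (hg h)).2.1
  obtain ⟨F, hF⟩ := claim
  let T : Finset (Finset N) := F.powerset.filter fun t =>
    ∃ b, {a | (a, b) ∈ R} ∈ p ∧ t = F.filter fun a => (a, b) ∈ R
  have h1 : {b | {a | (a, b) ∈ R} ∈ p} =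
      ⋃ t ∈ T, ⋂ a ∈ F, {b | (a, b) ∈ R ↔ a ∈ t} := by
    ext c
    simp only [Set.mem_iUnion, Set.mem_iInter, Set.mem_ofPred_eq, exists_prop]
    constructor
    · intro hc
      refine ⟨F.filter fun a => (a, c) ∈ R, Finset.mem_filter.2
        ⟨Finset.mem_powerset.2 (Finset.filter_subset _ _), c, hc, rfl⟩, fun a ha => ?_⟩
      simp [ha]
    · rintro ⟨t, ht, hc⟩
      obtain ⟨-, b, hb, rfl⟩ := Finset.mem_filter.1 ht
      refine hF b c (fun a ha => ?_) hb
      rw [hc a ha]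
      simp [ha]
  rw [h1]
  refine definable₁_biUnion T _ fun t => definable₁_biInter F _ fun a => ?_
  have h2 := definable₁_section' hR a
  by_cases hat : a ∈ t
  · simpa only [hat, iff_true] using h2
  · simp only [hat, iff_false]
    exact h2.compl

/-- The image of a type under a map. -/
def pushType (L : FirstOrder.Language.{u, v}) {N : Type*} [L.Structure N] (f : N → N)
    (p : Set (Set N)) : Set (Set N) :=
  {X | (univ : Set N).Definable₁ L X ∧ f ⁻¹' X ∈ p}

/-- The unary map `f` is definable. -/
def DefinableMap₁ (L : FirstOrder.Language.{u, v}) {N : Type*} [L.Structure N] (f : N → N) :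
    Prop :=
  (univ : Set N).DefinableFun L fun v : Fin 1 → N => f (v 0)

theorem DefinableMap₁.preimage {f : N → N} (hf : DefinableMap₁ L f)
    (hX : (univ : Set N).Definable₁ L X) : (univ : Set N).Definable₁ L (f ⁻¹' X) :=
  Set.DefinableFun.preimage_definable₁ (f := fun v : Fin 1 → N => f (v 0)) hf hX

theorem IsGenericType.pushType (hG : IsGenericity L Gen d) (hp : IsGenericType L Gen p)
    {f g : N → N} (hf : DefinableMap₁ L f) (hgf : ∀ x, g (f x) = x)
    (hfg : ∀ x, f (g x) = x) : IsGenericType L Gen (pushType L f p) := by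
  refine ⟨fun X hX => ?_, fun X hX Y hY => ⟨hX.1.inter hY.1, hp.inter _ hX.2 _ hY.2⟩,
    fun X hX => (hp.mem_or_compl_mem _ (hf.preimage hX)).imp (fun h => ⟨hX, h⟩)
      fun h => ⟨hX.compl, h⟩⟩
  have h1 : f '' (f ⁻¹' X) = X := Set.image_preimage_eq X fun x => ⟨g x, hfg x⟩
  have h2 := hG.image f (Function.LeftInverse.injective hgf) hf _ (hp.gen _ hX.2)
  rwa [h1] at h2

theorem pushType_pushType {f g : N → N} (hf : DefinableMap₁ L f) :
    pushType L f (pushType L g p) = pushType L (fun x => f (g x)) p := by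
  ext X
  exact ⟨fun h => ⟨h.1, h.2.2⟩, fun h => ⟨h.1, hf.preimage h.1, h.2⟩⟩

theorem IsGenericType.pushType_id (hG : IsGenericity L Gen d) (hp : IsGenericType L Gen p)
    {f : N → N} (hf : ∀ x, f x = x) : ModelTheory.pushType L f p = p := by
  have : f = id := funext hf
  subst this
  ext X
  exact ⟨fun h => h.2, fun h => ⟨hG.definable _ (hp.gen _ h), h⟩⟩

/-- The space of generic types. -/
def GenericType (L : FirstOrder.Language.{u, v}) {N : Type*} [L.Structure N]
    (Gen : Set N → Prop) : Type _ :=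
  {p : Set (Set N) // IsGenericType L Gen p}

theorem finite_genericType (hG : IsGenericity L Gen d) : Finite (GenericType L Gen) := by
  obtain ⟨A, P, hP, -, -, h1, h2⟩ := hG.exists_isolating
  refine Finite.of_surjective (fun i => (⟨P i, hP i⟩ : GenericType L Gen)) fun p => ?_
  obtain ⟨i, hi⟩ := h1 p.1 p.2
  exact ⟨i, Subtype.ext (h2 i p.1 p.2 hi).symm⟩

theorem le_natCard_genericType (hG : IsGenericity L Gen d) :
    d ≤ Nat.card (GenericType L Gen) := by
  have := finite_genericType hG
  obtain ⟨A, P, hP, -, hinj, -⟩ := hG.exists_isolating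
  let P' : Fin d → GenericType L Gen := fun i => ⟨P i, hP i⟩
  have h1 := Nat.card_le_card_of_injective P' fun i k h => hinj (congrArg Subtype.val h)
  rwa [Nat.card_fin] at h1

theorem exists_isolating_set (hG : IsGenericity L Gen d) (q : GenericType L Gen) :
    ∃ X ∈ q.1, ∀ p, IsGenericType L Gen p → X ∈ p → p = q.1 := by
  obtain ⟨A, P, -, -, -, h1, h2⟩ := hG.exists_isolating
  obtain ⟨i, hi⟩ := h1 q.1 q.2
  exact ⟨A i, hi, fun p hp hip => (h2 i p hp hip).trans (h2 i q.1 q.2 hi).symm⟩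

end GenericType

end ModelTheory

/-! ### The kernel of the action on the generic types -/

namespace KLoop

open FirstOrder FirstOrder.Language ModelTheory Set

variable {L : FirstOrder.Language.{u, v}} {N : Type*} [L.Structure N] [KLoop N]

theorem DefinableLaw.addLeft (h : DefinableLaw L N) (a : N) : DefinableMap₁ L fun x => a + x :=
  h.add (definableFun_const a) (DefinableFun.proj L)

theorem DefinableLaw.addRight (h : DefinableLaw L N) (a : N) : DefinableMap₁ L fun x => x + a :=
  h.add (DefinableFun.proj L) (definableFun_const a)

theorem DefinableLaw.quad (h : DefinableLaw L N) (a : N) : DefinableMap₁ L (KLoop.quad a) :=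
  h.add (definableFun_const a) (h.addRight a)

/-- The inverse of a right translation. -/
def subRight (b y : N) : N := -b + ((b + y) + -b)

theorem subRight_add (b y : N) : subRight b y + b = y := rightDiv_add b y

theorem add_subRight (b x : N) : subRight b (x + b) = x :=
  add_right_inj'.1 (subRight_add b (x + b))

theorem DefinableLaw.subRight (h : DefinableLaw L N) (a : N) :
    DefinableMap₁ L (KLoop.subRight a) :=
  h.add (definableFun_const _) (h.add (h.addLeft a) (definableFun_const _))

/-- A definable subloop `K`, closed under halving, together with finitely many points whose
quadratic maps carry `K` onto the parts of a partition of the loop. -/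
structure IsQuadraticPartition (L : FirstOrder.Language.{u, v}) {N : Type*} [L.Structure N]
    [KLoop N] (K : Set N) {n : ℕ} (e : Fin n → N) : Prop where
  definable : (univ : Set N).Definable₁ L K
  isSubloop : IsSubloop K
  half_mem : ∀ x, x + x ∈ K → x ∈ K
  disjoint : Pairwise fun i k => Disjoint (KLoop.quad (e i) '' K) (KLoop.quad (e k) '' K)
  cover : ∀ x, ∃ i, x ∈ KLoop.quad (e i) '' K

section GenericTypes

variable {Gen : Set N → Prop} {d : ℕ}

/-- The action of the left translation by `a` on the generic types. -/
def act (hG : IsGenericity L Gen d) (h : DefinableLaw L N) (a : N) (p : GenericType L Gen) :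
    GenericType L Gen :=
  ⟨pushType L (fun x => a + x) p.1, p.2.pushType hG (h.addLeft a) (g := fun x => -a + x)
    (neg_add_cancel_left' a) (add_neg_cancel_left' a)⟩

variable {hG : IsGenericity L Gen d} {h : DefinableLaw L N}

theorem act_quad (a b : N) (p : GenericType L Gen) :
    act hG h (KLoop.quad a b) p = act hG h a (act hG h b (act hG h a p)) := by
  refine Subtype.ext ?_
  change pushType L _ _ = pushType L _ (pushType L _ (pushType L _ _))
  rw [pushType_pushType (h.addLeft b), pushType_pushType (h.addLeft a)]
  congr 1
  funext x
  exact quad_add a b x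

theorem act_add_self (a : N) (p : GenericType L Gen) :
    act hG h (a + a) p = act hG h a (act hG h a p) := by
  refine Subtype.ext ?_
  change pushType L _ _ = pushType L _ (pushType L _ _)
  rw [pushType_pushType (h.addLeft a)]
  congr 1
  funext x
  exact add_self_add a x

theorem act_zero (p : GenericType L Gen) : act hG h 0 p = p :=
  Subtype.ext (p.2.pushType_id hG zero_add')

theorem act_neg_act (a : N) (p : GenericType L Gen) : act hG h (-a) (act hG h a p) = p := by
  refine Subtype.ext ?_
  change pushType L _ (pushType L _ _) = _
  rw [pushType_pushType (h.addLeft (-a))]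
  exact p.2.pushType_id hG (neg_add_cancel_left' a)

theorem act_act_neg (a : N) (p : GenericType L Gen) : act hG h a (act hG h (-a) p) = p := by
  have := act_neg_act (hG := hG) (h := h) (-a) p
  rwa [neg_neg'] at this

/-- The elements whose left translations fix all generic types. -/
def genericKernel (hG : IsGenericity L Gen d) (h : DefinableLaw L N) : Set N :=
  {a | act hG h a = id}

/-- Since every element is a double, squaring is surjective, hence injective, on the finite set of
the permutations of the generic types that come from left translations. -/
theorem mem_genericKernel_of_add_self_mem (hdiv : UniquelyTwoDivisible N) {a : N}
    (ha : a + a ∈ genericKernel hG h) : a ∈ genericKernel hG h := by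
  have := finite_genericType hG
  let T := Set.range (act hG h)
  have hsq : ∀ a, act hG h (a + a) = act hG h a ∘ act hG h a := fun a => funext (act_add_self a)
  let sq : T → T := fun σ => ⟨σ.1 ∘ σ.1, by
    obtain ⟨b, hb⟩ := σ.2
    exact ⟨b + b, by rw [hsq, hb]⟩⟩
  have hsurj : Function.Surjective sq := by
    rintro ⟨_, c, rfl⟩
    obtain ⟨b, rfl⟩ := hdiv.2 c
    exact ⟨⟨_, b, rfl⟩, Subtype.ext (hsq b).symm⟩
  have hinj := Finite.injective_iff_surjective.2 hsurj
  have h0 : act hG h 0 = id := funext act_zero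
  have h1 : sq ⟨_, a, rfl⟩ = sq ⟨_, 0, rfl⟩ := by
    refine Subtype.ext ?_
    change act hG h a ∘ act hG h a = act hG h 0 ∘ act hG h 0
    rw [← hsq, h0]
    exact ha
  exact (congrArg Subtype.val (hinj h1)).trans h0

theorem isSubloop_genericKernel (hdiv : UniquelyTwoDivisible N) :
    IsSubloop (genericKernel hG h) := by
  have hneg : ∀ a ∈ genericKernel hG h, -a ∈ genericKernel hG h := by
    intro a ha
    refine funext fun p => ?_
    have h1 := act_neg_act (hG := hG) (h := h) a p
    rwa [show act hG h a p = p from congrFun ha p] at h1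
  have hadd : ∀ a ∈ genericKernel hG h, ∀ b ∈ genericKernel hG h,
      a + b ∈ genericKernel hG h := by
    intro a ha b hb
    refine mem_genericKernel_of_add_self_mem hdiv (funext fun p => ?_)
    have ha' : ∀ p, act hG h a p = p := congrFun ha
    have hb' : ∀ p, act hG h b p = p := congrFun hb
    rw [add_add_self]
    change act hG h (KLoop.quad a (b + b)) p = p
    rw [act_quad, act_add_self, ha', ha', hb', hb']
  exact .of_neg_mem (funext act_zero) hadd hneg

theorem definable₁_genericKernel : (univ : Set N).Definable₁ L (genericKernel hG h) := by
  have := finite_genericType hG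
  have := Fintype.ofFinite (GenericType L Gen)
  choose X hX hiso using exists_isolating_set hG
  have h1 : genericKernel hG h =
      ⋂ p ∈ (Finset.univ : Finset (GenericType L Gen)), {a | {x | a + x ∈ X p} ∈ p.1} := by
    ext a
    simp only [Finset.mem_univ, iInter_true, mem_iInter]
    constructor
    · intro ha p
      have h2 : X p ∈ (act hG h a p).1 := by
        rw [show act hG h a p = p from congrFun ha p]
        exact hX p
      exact h2.2
    · intro ha
      exact funext fun p => Subtype.ext (hiso p _ (act hG h a p).2
        ⟨hG.definable _ (p.2.gen _ (hX p)), ha p⟩)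
  rw [h1]
  refine definable₁_biInter _ _ fun p => ?_
  have hR : (univ : Set N).Definable₂ L {c : N × N | c.2 + c.1 ∈ X p} := by
    have h2 : (univ : Set N).DefinableFun L fun v : Fin 2 → N => v 1 + v 0 :=
      h.add (DefinableFun.proj L) (DefinableFun.proj L)
    exact h2.preimage_definable₁ (hG.definable _ (p.2.gen _ (hX p)))
  exact p.2.definable hG hR

/-- The kernel belongs to at most one generic type. If it belongs to `p` and to `q`, consider the
sums `a + b` with `a` in `p` and `b` in `q`. Left translation by an element `a` of the kernel fixes
`q`; since `a + b ∈ X` does not define an order on an infinite sequence, right translation by `b`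
takes `p` to `q`, for `q`-almost all `b` in the kernel. The same holds with `q` in place of `p`, and
right translations are injective on types. -/
theorem eq_of_genericKernel_mem {p q : GenericType L Gen}
    (hp : genericKernel hG h ∈ p.1) (hq : genericKernel hG h ∈ q.1) : p = q := by
  let K := genericKernel hG h
  obtain ⟨X, hX, hiso⟩ := exists_isolating_set hG q
  have hXdef := hG.definable _ (q.2.gen _ hX)
  have hR : (univ : Set N).Definable₂ L {c : N × N | c.1 + c.2 ∈ X} := by
    have h2 : (univ : Set N).DefinableFun L fun v : Fin 2 → N => v 0 + v 1 :=
      h.add (DefinableFun.proj L) (DefinableFun.proj L)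
    exact h2.preimage_definable₁ hXdef
  have key : ∀ r : GenericType L Gen, K ∈ r.1 → {b | {a | a + b ∈ X} ∈ r.1} ∈ q.1 := by
    intro r hr
    have hCdef : (univ : Set N).Definable₁ L {b | {a | a + b ∈ X} ∈ r.1} := r.2.definable hG hR
    refine (q.2.mem_or_compl_mem _ hCdef).resolve_right fun hC => ?_
    obtain ⟨t, ht, ht'⟩ := exists_seq_of_forall_finset_exists
      (fun t : N × N => t.1 ∈ K ∧ t.2 ∈ {b | {a | a + b ∈ X} ∈ r.1}ᶜ)
      (fun t t' => t.1 + t'.2 ∈ X ∧ t'.1 + t.2 ∉ X) fun s hs => by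
        have h1 : ({b | {a | a + b ∈ X} ∈ r.1}ᶜ ∩ ⋂ t ∈ s, {b | t.1 + b ∈ X}) ∈ q.1 := by
          refine q.2.inter _ hC _ (q.2.biInter_mem hG s _ fun t ht => ?_)
          have h2 : X ∈ (act hG h t.1 q).1 := by
            rw [show act hG h t.1 q = q from congrFun (hs t ht).1 q]
            exact hX
          exact h2.2
        have h3 : (K ∩ ⋂ t ∈ s, {a | a + t.2 ∈ X}ᶜ) ∈ r.1 := by
          refine r.2.inter _ hr _ (r.2.biInter_mem hG s _ fun t ht => ?_)
          exact (r.2.mem_or_compl_mem _ ((h.addRight t.2).preimage hXdef)).resolve_left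
            (hs t ht).2
        obtain ⟨b, hb, hb'⟩ := hG.nonempty _ (q.2.gen _ h1)
        obtain ⟨a, ha, ha'⟩ := hG.nonempty _ (r.2.gen _ h3)
        simp only [mem_iInter] at hb' ha'
        exact ⟨(a, b), ⟨ha, hb⟩, fun t ht => ⟨hb' t ht, ha' t ht⟩⟩
    exact hG.not_order _ hR (fun n => (t n).1) (fun n => (t n).2) (fun m n hmn => (ht' m n hmn).1)
      fun m n hmn => (ht' n m hmn).2
  obtain ⟨b, hb, hb'⟩ := hG.nonempty _ (q.2.gen _ (q.2.inter _ (key p hp) _ (key q hq)))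
  have hpush : ∀ r : GenericType L Gen, {a | a + b ∈ X} ∈ r.1 →
      pushType L (fun x => x + b) r.1 = q.1 := fun r hr =>
    hiso _ (r.2.pushType hG (h.addRight b) (g := KLoop.subRight b) (add_subRight b)
      (subRight_add b)) ⟨hXdef, hr⟩
  have hback : ∀ r : GenericType L Gen,
      pushType L (KLoop.subRight b) (pushType L (fun x => x + b) r.1) = r.1 := fun r => by
    rw [pushType_pushType (h.subRight b)]
    exact r.2.pushType_id hG (add_subRight b)
  refine Subtype.ext ?_
  rw [← hback p, ← hback q, hpush p hb, hpush q hb']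

/-- The permutation induced by `e + e` is realized exactly on the image of the kernel under the
quadratic map of `e`. -/
theorem image_quad_genericKernel (e : N) :
    KLoop.quad e '' genericKernel hG h = {x | act hG h x = act hG h (e + e)} := by
  ext x
  constructor
  · rintro ⟨k, hk, rfl⟩
    refine funext fun p => ?_
    rw [act_quad, act_add_self]
    exact congrArg _ (congrFun hk _)
  · intro hx
    refine ⟨KLoop.quad (-e) x, funext fun p => ?_, quad_quad_neg e x⟩
    rw [act_quad, show act hG h x = act hG h (e + e) from hx, act_add_self, act_act_neg,
      act_neg_act]
    rfl

/-- The loop has a quadratic partition into at least `d` parts: the fibres of the action on the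
generic types. -/
theorem exists_isQuadraticPartition_of_isGenericity (hG : IsGenericity L Gen d)
    (h : DefinableLaw L N) (hdiv : UniquelyTwoDivisible N) :
    ∃ (K : Set N) (n : ℕ) (e : Fin n → N), IsQuadraticPartition L K e ∧ d ≤ n := by
  classical
  have := finite_genericType hG
  let K := genericKernel hG h
  let T := Set.range (act hG h)
  have hT : Finite T := inferInstance
  have hroot : ∀ σ : T, ∃ e, act hG h (e + e) = σ.1 := by
    rintro ⟨_, c, rfl⟩
    obtain ⟨e, rfl⟩ := hdiv.2 c
    exact ⟨e, rfl⟩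
  choose e he using hroot
  have himg : ∀ σ : T, KLoop.quad (e σ) '' K = {x | act hG h x = σ.1} := fun σ => by
    rw [image_quad_genericKernel, he]
  have hdef : ∀ σ : T, (univ : Set N).Definable₁ L {x | act hG h x = σ.1} := by
    intro σ
    have h1 : {x | act hG h x = σ.1} = KLoop.quad (-e σ) ⁻¹' K := by
      rw [← himg]
      ext x
      constructor
      · rintro ⟨k, hk, rfl⟩
        rw [mem_preimage, quad_neg_quad]
        exact hk
      · exact fun hx => ⟨_, hx, quad_quad_neg _ _⟩
    rw [h1]
    exact (h.quad _).preimage definable₁_genericKernel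
  have hcard : d ≤ Nat.card T := by
    have := Fintype.ofFinite T
    -- each generic type chooses the fibre of the action that belongs to it
    have hfib : ∀ p : GenericType L Gen, ∃ σ : T, {x | act hG h x = σ.1} ∈ p.1 := by
      intro p
      obtain ⟨σ, -, hσ⟩ := p.2.exists_mem_of_biUnion_mem hG Finset.univ
        (fun σ : T => {x | act hG h x = σ.1}) hdef (by
          have h1 : (⋃ σ ∈ (Finset.univ : Finset T), {x | act hG h x = σ.1}) = Set.univ := by
            ext x
            simp only [mem_iUnion, mem_univ, iff_true]
            exact ⟨⟨_, x, rfl⟩, Finset.mem_univ _, rfl⟩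
          rw [h1]
          exact p.2.univ_mem hG)
      exact ⟨σ, hσ⟩
    choose τ hτ using hfib
    refine (le_natCard_genericType hG).trans (Nat.card_le_card_of_injective τ fun p q hpq => ?_)
    let ε := e (τ p)
    have hpush : ∀ r : GenericType L Gen, {x | act hG h x = (τ p).1} ∈ r.1 →
        K ∈ pushType L (KLoop.quad (-ε)) r.1 := by
      intro r hr
      refine ⟨definable₁_genericKernel, r.2.mem_of_subset hG hr
        ((h.quad _).preimage definable₁_genericKernel) ?_⟩
      rw [← himg]
      rintro _ ⟨k, hk, rfl⟩
      rw [mem_preimage, quad_neg_quad]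
      exact hk
    have hgen : ∀ r : GenericType L Gen,
        IsGenericType L Gen (pushType L (KLoop.quad (-ε)) r.1) := fun r =>
      r.2.pushType hG (h.quad _) (g := KLoop.quad ε) (quad_quad_neg ε) (quad_neg_quad ε)
    have h1 := eq_of_genericKernel_mem (hG := hG) (h := h) (p := ⟨_, hgen p⟩)
      (q := ⟨_, hgen q⟩) (hpush p (hτ p)) (hpush q (hpq ▸ hτ q))
    have h2 := congrArg (pushType L (KLoop.quad ε)) (congrArg Subtype.val h1)
    have hback : ∀ r : GenericType L Gen,
        pushType L (KLoop.quad ε) (pushType L (KLoop.quad (-ε)) r.1) = r.1 := fun r => by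
      rw [pushType_pushType (h.quad ε)]
      exact r.2.pushType_id hG (quad_quad_neg ε)
    refine Subtype.ext ?_
    rw [← hback p, ← hback q]
    exact h2
  let ν := (Finite.equivFin T).symm
  refine ⟨K, Nat.card T, fun i => e (ν i), ⟨definable₁_genericKernel,
    isSubloop_genericKernel hdiv, fun x hx => mem_genericKernel_of_add_self_mem hdiv hx,
    fun i k hik => ?_, fun x => ?_⟩, hcard⟩
  · refine Set.disjoint_left.2 fun x hx hx' => hik (ν.injective (Subtype.ext ?_))
    rw [himg] at hx hx'
    exact Eq.trans (Eq.symm hx) hx'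
  · refine ⟨ν.symm ⟨_, x, rfl⟩, ?_⟩
    rw [himg, Equiv.apply_symm_apply]
    rfl

end GenericTypes

end KLoop

/-! ### Morley rank of definable sets -/

namespace ModelTheory

open FirstOrder FirstOrder.Language Filter Set

/-- The rank does not depend on how the universe of the structures is written. -/
theorem formulaRankGE_universe (L : FirstOrder.Language.{u, v}) (α : Ordinal.{max u v w}) :
    ∀ {N : Type (max u v w)} [L.Structure N] {φ : L.Formula (N ⊕ Unit)},
      FormulaRankGE.{u, v, max u v w} L α N φ ↔ FormulaRankGE.{u, v, w} L α N φ := by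
  induction α using WellFoundedLT.induction with
  | _ α ih =>
    intro N _ φ
    rw [formulaRankGE_iff.{u, v, w}, formulaRankGE_iff.{u, v, max u v w}]
    refine and_congr_right fun _ => forall₂_congr fun β hβ => ?_
    constructor
    · rintro ⟨N', _, j, ψ, h1, h2, h3⟩
      exact ⟨N', _, j, ψ, h1, h2, fun i => (ih β hβ).1 (h3 i)⟩
    · rintro ⟨N', _, j, ψ, h1, h2, h3⟩
      exact ⟨N', _, j, ψ, h1, h2, fun i => (ih β hβ).2 (h3 i)⟩

section SetRank

variable {L : FirstOrder.Language.{u, v}} {B : Type w} [L.Structure B]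
  {α β : Ordinal.{max u v w}} {D : Set B}

/-- The definable set `D` has Morley rank at least `α`. -/
def SetRankGE (L : FirstOrder.Language.{u, v}) {B : Type w} [L.Structure B]
    (α : Ordinal.{max u v w}) (D : Set B) : Prop :=
  ∃ φ : L.Formula (B ⊕ Unit), solutionSet φ = D ∧
    ∃ (N : Type (max u v w)) (_ : L.Structure N) (j : B ↪ₑ[L] N),
      FormulaRankGE.{u, v, w} L α N (transport j φ)

/-- The rank of a definable set can be computed in any elementary extension. -/
theorem setRankGE_solutionSet_iff {φ : L.Formula (B ⊕ Unit)} {N : Type (max u v w)}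
    [L.Structure N] (j : B ↪ₑ[L] N) :
    SetRankGE.{u, v, w} L α (solutionSet φ) ↔ FormulaRankGE.{u, v, w} L α N (transport j φ) := by
  refine ⟨?_, fun h => ⟨φ, rfl, N, _, j, h⟩⟩
  rintro ⟨φ', hφ, N', _, j', h⟩
  have : Nonempty N := ⟨j ((solutionSet_transport_nonempty j').1 h.nonempty).some⟩
  obtain ⟨U, k, hk⟩ := exists_amalgam j j'
  refine .of_transport (diag L U N) ((h.transport α k).mono ?_)
  rw [← solutionSet_transport_transport j' k j (diag L U N) hk]
  exact (solutionSet_transport_subset k).2 ((solutionSet_transport_subset j').2 hφ.le)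

theorem SetRankGE.nonempty (h : SetRankGE.{u, v, w} L α D) : D.Nonempty := by
  obtain ⟨φ, rfl, N, _, j, h⟩ := h
  exact (solutionSet_transport_nonempty j).1 h.nonempty

theorem SetRankGE.of_le (h : SetRankGE.{u, v, w} L α D) (hβ : β ≤ α) :
    SetRankGE.{u, v, w} L β D := by
  obtain ⟨φ, rfl, N, _, j, h⟩ := h
  exact ⟨φ, rfl, N, _, j, h.of_le hβ⟩

theorem SetRankGE.mono (h : SetRankGE.{u, v, w} L α D) {E : Set B}
    (hE : (univ : Set B).Definable₁ L E) (hDE : D ⊆ E) : SetRankGE.{u, v, w} L α E := by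
  obtain ⟨φ, rfl, N, _, j, h⟩ := h
  obtain ⟨ψ, rfl⟩ := definable₁_iff_exists_solutionSet.1 hE
  exact ⟨ψ, rfl, N, _, j, h.mono ((solutionSet_transport_subset j).2 hDE)⟩

theorem morleyRank_eq_sSup : morleyRank.{u, v, w} L D =
    sSup ({r | ∃ α : Ordinal.{max u v w}, r = ((α : WithTop Ordinal.{max u v w}) : WithBot _) ∧
      SetRankGE.{u, v, w} L α D} : Set (WithBot (WithTop Ordinal.{max u v w}))) := rfl

theorem morleyRank_eq_of_setRankGE (h : SetRankGE.{u, v, w} L α D)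
    (hn : ¬SetRankGE.{u, v, w} L (Order.succ α) D) :
    morleyRank.{u, v, w} L D = ((α : WithTop Ordinal.{max u v w}) : WithBot _) := by
  rw [morleyRank_eq_sSup]
  refine IsGreatest.csSup_eq ⟨⟨α, rfl, h⟩, ?_⟩
  rintro _ ⟨β, rfl, hβ⟩
  refine WithBot.coe_le_coe.2 (WithTop.coe_le_coe.2 (not_lt.1 fun hlt => hn (hβ.of_le ?_)))
  exact Order.succ_le_of_lt hlt

theorem morleyRank_empty : morleyRank.{u, v, w} L (∅ : Set B) = ⊥ := by
  have h (r : WithBot (WithTop Ordinal.{max u v w})) : ¬∃ α : Ordinal.{max u v w},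
      r = ((α : WithTop Ordinal.{max u v w}) : WithBot _) ∧
        SetRankGE.{u, v, w} L α (∅ : Set B) :=
    fun ⟨_, _, h⟩ => Set.not_nonempty_empty h.nonempty
  rw [morleyRank_eq_sSup, Set.eq_empty_of_forall_notMem h]
  exact WithBot.sSup_empty

/-- Below the maximal rank `α`, a definable set has rank `α` if and only if its rank is at
least `α`. -/
theorem morleyRank_eq_coe_iff (hD : (univ : Set B).Definable₁ L D)
    (hn : ¬SetRankGE.{u, v, w} L (Order.succ α) D) :
    morleyRank.{u, v, w} L D = ((α : WithTop Ordinal.{max u v w}) : WithBot _) ↔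
      SetRankGE.{u, v, w} L α D := by
  refine ⟨fun h => ?_, fun h => morleyRank_eq_of_setRankGE h hn⟩
  by_contra hα
  rcases D.eq_empty_or_nonempty with rfl | hne
  · rw [morleyRank_empty] at h
    exact WithBot.bot_ne_coe h
  obtain ⟨φ, rfl⟩ := definable₁_iff_exists_solutionSet.1 hD
  have : Nonempty B := ⟨hne.some⟩
  let U : Ultrafilter PUnit.{max u v w + 1} := pure PUnit.unit
  let j := diag L U B
  have hiff : ∀ β, SetRankGE.{u, v, w} L β (solutionSet φ) ↔
      FormulaRankGE.{u, v, w} L β (Ultrapower U B) (transport j φ) := fun β =>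
    setRankGE_solutionSet_iff j
  rw [hiff] at hα
  obtain ⟨β, hβα, h1, h2⟩ := exists_rank_of_not_formulaRankGE
    ((solutionSet_transport_nonempty j).2 hne) hα
  rw [← hiff] at h1 h2
  rw [morleyRank_eq_of_setRankGE h1 h2] at h
  exact hβα.ne (WithTop.coe_injective (WithBot.coe_injective h))

theorem setRankGE_self_iff {N : Type (max u v w)} [L.Structure N] {φ : L.Formula (N ⊕ Unit)} :
    SetRankGE.{u, v, max u v w} L α (solutionSet φ) ↔ FormulaRankGE.{u, v, w} L α N φ := by
  have h := setRankGE_solutionSet_iff.{u, v, max u v w} (φ := φ) (α := α)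
    (ElementaryEmbedding.refl L N)
  rw [h, formulaRankGE_universe.{u, v, w}, formulaRankGE_transport_iff]

end SetRank

section RankGeneric

variable {L : FirstOrder.Language.{u, v}} {B : Type*} [L.Structure B]
  {N : Type (max u v w)} [L.Structure N] {α : Ordinal.{max u v w}}

/-- The subset `D` of `B` is definable, of rank at least `α` in the elementary extension `N`. -/
def RankGeneric (j : B ↪ₑ[L] N) (α : Ordinal.{max u v w}) (D : Set B) : Prop :=
  ∃ φ : L.Formula (B ⊕ Unit), solutionSet φ = D ∧ FormulaRankGE.{u, v, w} L α N (transport j φ)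

theorem rankGeneric_solutionSet_iff {j : B ↪ₑ[L] N} {φ : L.Formula (B ⊕ Unit)} :
    RankGeneric.{u, v, w} j α (solutionSet φ) ↔
      FormulaRankGE.{u, v, w} L α N (transport j φ) := by
  refine ⟨?_, fun h => ⟨φ, rfl, h⟩⟩
  rintro ⟨ψ, hψ, h⟩
  exact h.mono ((solutionSet_transport_subset j).2 hψ.le)

theorem isLargeness_rankGeneric (j : B ↪ₑ[L] N) {d : ℕ}
    (htop : FormulaRankGE.{u, v, w} L α N ⊤)
    (hmax : ∀ (n : ℕ) (ψ : Fin n → L.Formula (N ⊕ Unit)),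
      (Pairwise fun i k => Disjoint (solutionSet (ψ i)) (solutionSet (ψ k))) →
      (∀ i, FormulaRankGE.{u, v, w} L α N (ψ i)) → n ≤ d) :
    IsLargeness L (RankGeneric.{u, v, w} j α) d where
  definable := by
    rintro _ ⟨φ, rfl, -⟩
    exact definable₁_solutionSet φ
  nonempty := by
    rintro _ ⟨φ, rfl, h⟩
    exact (solutionSet_transport_nonempty j).1 h.nonempty
  mono := by
    rintro _ Y ⟨φ, rfl, h⟩ hY hsub
    obtain ⟨ψ, rfl⟩ := definable₁_iff_exists_solutionSet.1 hY
    exact ⟨ψ, rfl, h.mono ((solutionSet_transport_subset j).2 hsub)⟩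
  union := by
    intro X Y hX hY h
    obtain ⟨φ, rfl⟩ := definable₁_iff_exists_solutionSet.1 hX
    obtain ⟨ψ, rfl⟩ := definable₁_iff_exists_solutionSet.1 hY
    rw [← solutionSet_sup, rankGeneric_solutionSet_iff] at h
    rw [rankGeneric_solutionSet_iff, rankGeneric_solutionSet_iff]
    refine FormulaRankGE.or_of_sup α (h.mono ?_)
    rw [solutionSet_transport_sup, solutionSet_sup]
  gen_univ := by
    refine ⟨⊤, solutionSet_top, htop.mono ?_⟩
    rw [solutionSet_transport_top]
    exact Set.subset_univ _
  image := by
    rintro f hf hdef _ ⟨φ, rfl, h⟩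
    have h1 : (univ : Set B).Definable L {x : Fin 2 → B | f (x 0) = x 1} :=
      Set.Definable.preimage_comp (fun o : Option (Fin 1) => o.elim (1 : Fin 2) fun _ => 0) hdef
    obtain ⟨χ, hχ⟩ := definable_iff_exists_formula.1 h1
    have hχ' : ∀ x y, χ.Realize (Sum.elim id ![x, y]) ↔ f x = y := fun x y => (hχ ![x, y]).symm
    have hinj : IsInjectiveRelation χ := by
      refine ⟨fun x => ⟨f x, (hχ' _ _).2 rfl⟩, fun x x' y hx hx' => hf ?_⟩
      rw [(hχ' _ _).1 hx, (hχ' _ _).1 hx']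
    refine ⟨imageFormula χ φ, ?_, (FormulaRankGE.image α (hinj.transport j) h).mono ?_⟩
    · ext y
      rw [mem_solutionSet_imageFormula]
      simp only [hχ']
      rfl
    · intro y hy
      rw [mem_solutionSet_imageFormula] at hy
      rw [mem_solutionSet_transport_imageFormula]
      obtain ⟨x, hx, hxy⟩ := hy
      exact ⟨x, hx, (realize_relabel_map j χ _).1 hxy⟩
  card_le := by
    intro ι _ X hX hdisj
    choose ψ hψ hrank using hX
    let e := (Fintype.equivFin ι).symm
    refine hmax _ (fun i => transport j (ψ (e i))) (fun i k hik => ?_) fun i => hrank _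
    refine (solutionSet_transport_disjoint j).2 ?_
    rw [hψ, hψ]
    exact hdisj fun h => hik (e.injective h)

end RankGeneric

end ModelTheory

/-! ### Passing to an ultrapower and back -/

namespace ModelTheory

open FirstOrder FirstOrder.Language Filter Set

section Degree

variable {L : FirstOrder.Language.{u, v}} {B : Type w} [L.Structure B]

/-- In an ω-stable structure, the rank `α` of the whole structure is an ordinal, its degree `d` is
finite, and the degree is attained in an ultrapower of the structure. -/
theorem OmegaStable.exists_rank_degree [Nonempty B] (hs : OmegaStable.{u, v, w} L B) :
    ∃ (α : Ordinal.{max u v w}) (d : ℕ),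
      SetRankGE.{u, v, w} L α (univ : Set B) ∧
      ¬SetRankGE.{u, v, w} L (Order.succ α) (univ : Set B) ∧
      (∀ (N : Type (max u v w)) [L.Structure N] (_ : B ↪ₑ[L] N) (n : ℕ)
        (ψ : Fin n → L.Formula (N ⊕ Unit)),
        (Pairwise fun i k => Disjoint (solutionSet (ψ i)) (solutionSet (ψ k))) →
        (∀ i, FormulaRankGE.{u, v, w} L α N (ψ i)) → n ≤ d) ∧
      ∃ (I : Type (max u v w)) (U : Ultrafilter I) (ψ : Fin d → L.Formula (Ultrapower U B ⊕ Unit)),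
        (Pairwise fun i k => Disjoint (solutionSet (ψ i)) (solutionSet (ψ k))) ∧
        ∀ i, FormulaRankGE.{u, v, w} L α (Ultrapower U B) (ψ i) := by
  classical
  let U₀ : Ultrafilter PUnit.{max u v w + 1} := pure PUnit.unit
  let N : Type (max u v w) := Ultrapower U₀ B
  let j₀ : B ↪ₑ[L] N := diag L U₀ B
  have hN : N ⊨ L.completeTheory B :=
    model_of_elementaryEmbedding j₀ (inferInstanceAs (B ⊨ L.completeTheory B))
  have hNe : Nonempty N := ⟨j₀ (Classical.arbitrary B)⟩
  obtain ⟨α₁, hα₁⟩ := hs.exists_not_formulaRankGE hN ⊤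
  obtain ⟨α, -, hα, hα'⟩ := exists_rank_of_not_formulaRankGE
    (by rw [solutionSet_top]; exact univ_nonempty) hα₁
  have hrank : ∀ β, SetRankGE.{u, v, w} L β (univ : Set B) ↔
      FormulaRankGE.{u, v, w} L β N ⊤ := fun β => by
    have htop : solutionSet (transport j₀ (⊤ : L.Formula (B ⊕ Unit))) =
        solutionSet (⊤ : L.Formula (N ⊕ Unit)) := by
      rw [solutionSet_transport_top, solutionSet_top]
    rw [← solutionSet_top (L := L), setRankGE_solutionSet_iff j₀]
    exact ⟨fun h => h.mono htop.le, fun h => h.mono htop.ge⟩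
  have hex : ∃ n, ¬HasDisjointFamily.{u, v, w} L α N ⊤ n := by
    by_contra! h
    exact hα' (formulaRankGE_succ_of_forall_hasDisjointFamily h)
  have hzero : HasDisjointFamily.{u, v, w} L α N ⊤ 0 :=
    ⟨N, inferInstance, ElementaryEmbedding.refl L N, Fin.elim0, fun i => i.elim0, fun i => i.elim0,
      fun i => i.elim0⟩
  obtain ⟨d, hd⟩ : ∃ d, Nat.find hex = d + 1 := Nat.exists_eq_succ_of_ne_zero fun h =>
    absurd hzero ((Nat.find_eq_zero hex).1 h)
  have hd₁ : ¬HasDisjointFamily.{u, v, w} L α N ⊤ (d + 1) := hd ▸ Nat.find_spec hex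
  have hd₂ : HasDisjointFamily.{u, v, w} L α N ⊤ d :=
    not_not.1 (Nat.find_min hex (hd ▸ Nat.lt_succ_self d))
  refine ⟨α, d, (hrank α).2 hα, fun h => hα' ((hrank _).1 h), ?_, ?_⟩
  · intro N' _ j n ψ h1 h2
    by_contra! hlt
    obtain ⟨U, k, -⟩ := exists_amalgam j₀ j
    refine hd₁ ⟨_, inferInstance, diag L U N, fun i => transport k (ψ (Fin.castLE hlt i)),
      fun i => ?_, fun i i' hi => ?_, fun i => (h2 _).transport α k⟩
    · rw [solutionSet_transport_top]
      exact Set.subset_univ _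
    · exact (solutionSet_transport_disjoint k).2 (h1 fun h => hi (Fin.castLE_injective hlt h))
  · obtain ⟨N', _, j, ψ, -, h1, h2⟩ := hd₂
    obtain ⟨U, k, -⟩ := exists_amalgam (ElementaryEmbedding.refl L B) (j.comp j₀)
    exact ⟨_, U, fun i => transport k (ψ i),
      fun i i' hi => (solutionSet_transport_disjoint k).2 (h1 hi), fun i => (h2 i).transport α k⟩

end Degree

end ModelTheory

namespace KLoop

open FirstOrder FirstOrder.Language Filter Set ModelTheory

section Ultrapower

variable {I : Type*} {U : Ultrafilter I} {B : Type*} [KLoop B]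

instance : Zero (Ultrapower U B) := ⟨ultraMk U fun _ => 0⟩

instance : Neg (Ultrapower U B) :=
  ⟨Quotient.map (fun x i => -x i) fun _ _ h => h.mono fun _ hi => congrArg _ hi⟩

instance : Add (Ultrapower U B) :=
  ⟨Quotient.map₂ (fun x y i => x i + y i) fun _ _ h _ _ h' =>
    h.mp (h'.mono fun _ hi' hi => congrArg₂ _ hi hi')⟩

theorem ultraMk_add (x y : I → B) :
    ultraMk U x + ultraMk U y = ultraMk U fun i => x i + y i := rfl

theorem ultraMk_neg (x : I → B) : -ultraMk U x = ultraMk U fun i => -x i := rfl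

instance : KLoop (Ultrapower U B) where
  zero_add' a := by
    obtain ⟨a, rfl⟩ := exists_ultraMk U a
    exact ultraMk_congr fun i => zero_add' (a i)
  add_zero' a := by
    obtain ⟨a, rfl⟩ := exists_ultraMk U a
    exact ultraMk_congr fun i => add_zero' (a i)
  existsUnique_left a b := by
    obtain ⟨a, rfl⟩ := exists_ultraMk U a
    obtain ⟨b, rfl⟩ := exists_ultraMk U b
    choose x hx _ using fun i => existsUnique_left (a i) (b i)
    refine ⟨ultraMk U x, ultraMk_congr hx, fun y hy => ?_⟩
    obtain ⟨y, rfl⟩ := exists_ultraMk U y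
    rw [ultraMk_add, ultraMk_eq_iff] at hy
    refine ultraMk_eq_iff.2 (hy.mono fun i hi => ?_)
    exact add_right_inj'.1 (hi.trans (hx i).symm)
  existsUnique_right a b := by
    obtain ⟨a, rfl⟩ := exists_ultraMk U a
    obtain ⟨b, rfl⟩ := exists_ultraMk U b
    choose x hx _ using fun i => existsUnique_right (a i) (b i)
    refine ⟨ultraMk U x, ultraMk_congr hx, fun y hy => ?_⟩
    obtain ⟨y, rfl⟩ := exists_ultraMk U y
    rw [ultraMk_add, ultraMk_eq_iff] at hy
    refine ultraMk_eq_iff.2 (hy.mono fun i hi => ?_)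
    exact add_left_inj'.1 (hi.trans (hx i).symm)
  add_neg' a := by
    obtain ⟨a, rfl⟩ := exists_ultraMk U a
    exact ultraMk_congr fun i => add_neg' (a i)
  bol a b c := by
    obtain ⟨a, rfl⟩ := exists_ultraMk U a
    obtain ⟨b, rfl⟩ := exists_ultraMk U b
    obtain ⟨c, rfl⟩ := exists_ultraMk U c
    exact ultraMk_congr fun i => bol (a i) (b i) (c i)
  neg_add' a b := by
    obtain ⟨a, rfl⟩ := exists_ultraMk U a
    obtain ⟨b, rfl⟩ := exists_ultraMk U b
    exact ultraMk_congr fun i => neg_add' (a i) (b i)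

theorem ultraMk_quad (x y : I → B) :
    quad (ultraMk U x) (ultraMk U y) = ultraMk U fun i => quad (x i) (y i) := rfl

theorem UniquelyTwoDivisible.ultrapower (h : UniquelyTwoDivisible B) :
    UniquelyTwoDivisible (Ultrapower U B) := by
  refine ⟨fun x y hxy => ?_, fun y => ?_⟩
  · obtain ⟨x, rfl⟩ := exists_ultraMk U x
    obtain ⟨y, rfl⟩ := exists_ultraMk U y
    exact ultraMk_eq_iff.2 ((ultraMk_eq_iff.1 hxy).mono fun i hi => h.1 hi)
  · obtain ⟨y, rfl⟩ := exists_ultraMk U y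
    choose x hx using fun i => h.2 (y i)
    exact ⟨ultraMk U x, ultraMk_congr hx⟩

theorem DefinableLaw.ultrapower {L : FirstOrder.Language.{u, v}} [L.Structure B]
    (h : DefinableLaw L B) : DefinableLaw L (Ultrapower U B) := by
  have : Nonempty B := ⟨0⟩
  obtain ⟨φ, hφ⟩ := definable_iff_exists_formula.1 h
  refine definable_iff_exists_formula.2 ⟨φ.relabel (Sum.map (diag L U B) id), fun t => ?_⟩
  choose x hx using fun k => exists_ultraMk U (t k)
  obtain rfl : (fun k => ultraMk U (x k)) = t := funext hx
  rw [Formula.realize_relabel, Sum.elim_comp_map, Function.id_comp, Function.comp_id,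
    realize_diag_ultraMk]
  simp only [← hφ]
  exact ultraMk_eq_iff

/-- A property of the points of `β` that holds along every sequence almost everywhere holds almost
everywhere for all points at once. -/
theorem eventually_forall_of_forall_eventually {β : Type*} [Nonempty β] {P : I → β → Prop}
    (h : ∀ x : I → β, ∀ᶠ i in (U : Filter I), P i (x i)) : ∀ᶠ i in (U : Filter I), ∀ b, P i b := by
  classical
  have h1 : ∀ i, ∃ b, P i b → ∀ b, P i b := fun i => by
    by_cases hi : ∀ b, P i b
    · exact ⟨Classical.arbitrary β, fun _ => hi⟩
    · obtain ⟨b, hb⟩ := not_forall.1 hi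
      exact ⟨b, fun hb' => absurd hb' hb⟩
  choose x hx using h1
  exact (h x).mono hx

/-- A quadratic partition of an ultrapower yields one of the structure itself. -/
theorem IsQuadraticPartition.of_ultrapower {L : FirstOrder.Language.{u, v}} [L.Structure B]
    {K : Set (Ultrapower U B)} {n : ℕ} {e : Fin n → Ultrapower U B}
    (hP : IsQuadraticPartition L K e) :
    ∃ (K' : Set B) (e' : Fin n → B), IsQuadraticPartition L K' e' := by
  obtain ⟨hdef, hK, hhalf, hdisj, hcov⟩ := hP
  have : Nonempty B := ⟨0⟩
  obtain ⟨φ, rfl⟩ := definable₁_iff_exists_solutionSet.1 hdef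
  choose rep hrep using exists_ultraMk (M := fun _ => B) U
  let S : I → Set B := fun i => solutionSet (φ.relabel (Sum.map (fun c => rep c i) id))
  have hS : ∀ i b, b ∈ S i ↔ φ.Realize (Sum.elim (fun c => rep c i) fun _ => b) := fun i b => by
    simp only [S, solutionSet, Set.mem_ofPred_eq]
    rw [Formula.realize_relabel, Sum.elim_comp_map]
    rfl
  have hmem : ∀ x : I → B, ultraMk U x ∈ solutionSet φ ↔ ∀ᶠ i in (U : Filter I), x i ∈ S i := by
    intro x
    have h := realize_ultraMk U φ (Sum.elim rep fun _ : Unit => x)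
    have e : (fun b => ultraMk U (Sum.elim rep (fun _ : Unit => x) b)) =
        Sum.elim id fun _ : Unit => ultraMk U x := by
      funext b
      rcases b with c | _
      · exact hrep c
      · rfl
    rw [e] at h
    refine h.trans (Filter.eventually_congr (Filter.Eventually.of_forall fun i => ?_))
    rw [hS]
    refine iff_of_eq (congrArg _ (funext fun b => ?_))
    rcases b with c | _ <;> rfl
  have h1 : ∀ᶠ i in (U : Filter I), (0 : B) ∈ S i := (hmem _).1 hK.zero_mem
  have h2 : ∀ᶠ i in (U : Filter I), ∀ p : B × B, p.1 ∈ S i → p.2 ∈ S i → p.1 + p.2 ∈ S i :=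
    eventually_forall_of_forall_eventually fun x => by
      rw [Ultrafilter.eventually_imp, Ultrafilter.eventually_imp]
      intro ha hb
      exact (hmem _).1 (hK.add_mem _ ((hmem _).2 ha) _ ((hmem _).2 hb))
  have h3 : ∀ᶠ i in (U : Filter I), ∀ a, a ∈ S i → -a ∈ S i :=
    eventually_forall_of_forall_eventually fun x => by
      rw [Ultrafilter.eventually_imp]
      intro ha
      exact (hmem _).1 (hK.neg_mem ((hmem _).2 ha))
  have h4 : ∀ᶠ i in (U : Filter I), ∀ a, a + a ∈ S i → a ∈ S i :=
    eventually_forall_of_forall_eventually fun x => by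
      rw [Ultrafilter.eventually_imp]
      intro ha
      exact (hmem _).1 (hhalf _ ((hmem _).2 ha))
  have h5 : ∀ᶠ i in (U : Filter I), ∀ k l, k ≠ l → ∀ p : B × B, p.1 ∈ S i → p.2 ∈ S i →
      ¬quad (rep (e k) i) p.1 = quad (rep (e l) i) p.2 := by
    refine Filter.eventually_all.2 fun k => Filter.eventually_all.2 fun l => ?_
    refine Filter.eventually_imp_distrib_left.2 fun hkl => ?_
    refine eventually_forall_of_forall_eventually fun x => ?_
    rw [Ultrafilter.eventually_imp, Ultrafilter.eventually_imp, Ultrafilter.eventually_not]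
    intro ha hb hab
    refine Set.disjoint_left.1 (hdisj hkl) ⟨_, (hmem _).2 ha, rfl⟩ ⟨_, (hmem _).2 hb, ?_⟩
    rw [← hrep (e k), ← hrep (e l), ultraMk_quad, ultraMk_quad]
    exact (ultraMk_eq_iff.2 hab).symm
  have h6 : ∀ᶠ i in (U : Filter I), ∀ b, ∃ k, quad (-rep (e k) i) b ∈ S i :=
    eventually_forall_of_forall_eventually fun x => by
      obtain ⟨k, y, hy, hyx⟩ := hcov (ultraMk U x)
      have h := quad_neg_quad (e k) y
      rw [hyx, ← hrep (e k), ultraMk_neg, ultraMk_quad] at h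
      rw [← h, hmem] at hy
      exact hy.mono fun i hi => ⟨k, hi⟩
  obtain ⟨i, h1, h2, h3, h4, h5, h6⟩ :=
    (h1.and (h2.and (h3.and (h4.and (h5.and h6))))).exists
  refine ⟨S i, fun k => rep (e k) i, definable₁_solutionSet _,
    .of_neg_mem h1 (fun a ha b hb => h2 (a, b) ha hb) h3, h4,
    fun k l hkl => Set.disjoint_left.2 ?_, fun x => ?_⟩
  · rintro _ ⟨a, ha, rfl⟩ ⟨b, hb, hab⟩
    exact h5 k l hkl (a, b) ha hb hab.symm
  · obtain ⟨k, hk⟩ := h6 x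
    exact ⟨k, _, hk, quad_quad_neg _ _⟩

end Ultrapower

end KLoop

/-! ### The connected component -/

namespace KLoop

open FirstOrder FirstOrder.Language Filter Set ModelTheory

section Component

variable {L : FirstOrder.Language.{u, v}} {B : Type*} [L.Structure B] [KLoop B]
  {Gen : Set B → Prop} {d : ℕ} {K : Set B} {n : ℕ} {e : Fin n → B}

theorem gen_image_quad (hG : IsLargeness L Gen d) (h : DefinableLaw L B) (a : B) {X : Set B}
    (hX : Gen X) : Gen (quad a '' X) :=
  hG.image _ (Function.LeftInverse.injective (quad_neg_quad a)) (h.quad a) X hX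

theorem definable₁_image_quad (h : DefinableLaw L B) (a : B) {X : Set B}
    (hX : (univ : Set B).Definable₁ L X) : (univ : Set B).Definable₁ L (quad a '' X) := by
  rw [Set.image_eq_preimage_of_inverse (quad_neg_quad a) (quad_quad_neg a)]
  exact (h.quad _).preimage hX

namespace IsQuadraticPartition

theorem pos (hP : IsQuadraticPartition L K e) : 0 < n := by
  obtain ⟨i, -⟩ := hP.cover 0
  exact i.pos

theorem exists_gen_inter (hP : IsQuadraticPartition L K e) (hG : IsLargeness L Gen d)
    (h : DefinableLaw L B) {X : Set B} (hX : Gen X) : ∃ i, Gen (X ∩ quad (e i) '' K) := by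
  obtain ⟨i, -, hi⟩ := hG.exists_gen_of_biUnion Finset.univ (fun i => X ∩ quad (e i) '' K)
    (fun i => (hG.definable _ hX).inter (definable₁_image_quad h _ hP.definable)) (by
      have : (⋃ i ∈ (Finset.univ : Finset (Fin n)), X ∩ quad (e i) '' K) = X := by
        ext x
        simp only [mem_iUnion, Finset.mem_univ, exists_const, mem_inter_iff, exists_and_left]
        exact and_iff_left (hP.cover x)
      rwa [this])
  exact ⟨i, hi⟩

theorem gen (hP : IsQuadraticPartition L K e) (hG : IsLargeness L Gen d)
    (h : DefinableLaw L B) : Gen K := by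
  obtain ⟨i, hi⟩ := hP.exists_gen_inter hG h hG.gen_univ
  rw [univ_inter] at hi
  have h1 := gen_image_quad hG h (-e i) hi
  rwa [image_image, image_congr fun x _ => quad_neg_quad (e i) x, image_id'] at h1

theorem card_le (hP : IsQuadraticPartition L K e) (hG : IsLargeness L Gen d)
    (h : DefinableLaw L B) : n ≤ d := by
  have h1 := hG.card_le (Fin n) (fun i => quad (e i) '' K)
    (fun i => gen_image_quad hG h _ (hP.gen hG h)) hP.disjoint
  rwa [Fintype.card_fin] at h1

/-- When there are as many parts as possible, any two generic subsets of the subloop `K` meet. -/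
theorem inter_nonempty (hP : IsQuadraticPartition L K e) (hG : IsLargeness L Gen d)
    (h : DefinableLaw L B) (hdn : d ≤ n) {X Y : Set B} (hX : Gen X) (hY : Gen Y) (hXK : X ⊆ K)
    (hYK : Y ⊆ K) : (X ∩ Y).Nonempty := by
  by_contra hXY
  let i : Fin n := ⟨0, hP.pos⟩
  have hinj : Function.Injective (quad (e i)) :=
    Function.LeftInverse.injective (quad_neg_quad (e i))
  refine hG.not_disjoint_of_family (fun i => quad (e i) '' K)
    (fun i => gen_image_quad hG h _ (hP.gen hG h)) hP.disjoint hdn i _ _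
    (gen_image_quad hG h (e i) hX) (gen_image_quad hG h (e i) hY)
    ((Set.disjoint_image_iff hinj).2 ?_) (image_mono hXK) (image_mono hYK)
  exact Set.disjoint_iff_inter_eq_empty.2 (Set.not_nonempty_iff_eq_empty.1 hXY)

/-- A convex generic subset `D` of `K` is all of `K`: for each point `y` of `K`, the set `D` meets
the set of the centres of the symmetries that carry a point of `D` to `y`, since both are generic
in `K`. -/
theorem subset_of_isConvexSubset (hP : IsQuadraticPartition L K e) (hG : IsLargeness L Gen d)
    (h : DefinableLaw L B) (hdiv : UniquelyTwoDivisible B) (hdn : d ≤ n) {D : Set B} (hD : Gen D)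
    (hDK : D ⊆ K) (hconv : IsConvexSubset D) : K ⊆ D := by
  intro y hy
  have hc : ∀ v, ∃ w, symm v w = y := fun v => by
    obtain ⟨w, -, hw⟩ := exists_symm_eq hdiv isSubloop_univ (fun _ _ => trivial) y trivial v trivial
    exact ⟨w, hw⟩
  choose c hc using hc
  have hcinj : Function.Injective c := fun v v' hv =>
    symm_left_injective (c v) ((hc v).trans ((hc v').symm.trans (by rw [hv])))
  have hcdef : DefinableMap₁ L c := by
    have h1 : (univ : Set B).DefinableFun L fun x : Option (Fin 1) → B => x (some 0) :=
      DefinableFun.proj L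
    have h2 : (univ : Set B).DefinableFun L fun x : Option (Fin 1) → B => x none :=
      DefinableFun.proj L
    have h3 := (h.add h2 (h.add (h.neg h1) h2)).ofPred_eq (definableFun_const (L := L) y)
    have e : (fun v : Fin 1 → B => c (v 0)).tupleGraph =
        {x : Option (Fin 1) → B | symm (x (some 0)) (x none) = y} := by
      ext x
      change c (x (some 0)) = x none ↔ symm (x (some 0)) (x none) = y
      rw [← hc (x (some 0)), (symm_right_injective hdiv _).eq_iff, eq_comm]
    rw [DefinableMap₁, DefinableFun, e]
    exact h3
  have hcK : c '' D ⊆ K := by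
    rintro _ ⟨v, hv, rfl⟩
    obtain ⟨w, hw, hwy⟩ := exists_symm_eq hdiv hP.isSubloop hP.half_mem y hy v (hDK hv)
    rwa [symm_right_injective hdiv v ((hc v).trans hwy.symm)]
  obtain ⟨_, hw, v, hv, rfl⟩ := hP.inter_nonempty hG h hdn hD (hG.image c hcinj hcdef D hD) hDK hcK
  rw [← hc v]
  exact hconv v hv _ hw

/-- A generic subloop without proper convex generic subsets is `K`: it lies in a single part of the
partition, and that part contains `0`, so that it is `K`. -/
theorem eq_of_forall_isConvexSubset (hP : IsQuadraticPartition L K e) (hG : IsLargeness L Gen d)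
    (h : DefinableLaw L B) (hdiv : UniquelyTwoDivisible B) (hdn : d ≤ n) {C : Set B} (hC : Gen C)
    (hCsub : IsSubloop C) (hconn : ∀ D ⊆ C, Gen D → IsConvexSubset D → C ⊆ D) : C = K := by
  obtain ⟨i, hi⟩ := hP.exists_gen_inter hG h hC
  have hCi : C ⊆ quad (e i) '' K := by
    refine (hconn _ inter_subset_left hi ?_).trans inter_subset_right
    rintro x ⟨hx, x', hx', rfl⟩ y ⟨hy, y', hy', rfl⟩
    refine ⟨hCsub.isConvexSubset _ hx _ hy, _, hP.isSubloop.isConvexSubset _ hx' _ hy', ?_⟩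
    exact quad_symm _ _ _
  have hei : e i ∈ K := by
    obtain ⟨k, hk, hk0⟩ := hCi hCsub.zero_mem
    have h1 : k = -(e i + e i) := by
      rw [← quad_neg_quad (e i) k, hk0, quad, zero_add', neg_add']
    refine hP.half_mem _ ?_
    rw [← neg_neg' (e i + e i), ← h1]
    exact hP.isSubloop.neg_mem hk
  have hCK : C ⊆ K := hCi.trans (by
    rintro _ ⟨k, hk, rfl⟩
    exact hP.isSubloop.add_mem _ hei _ (hP.isSubloop.add_mem _ hk _ hei))
  exact hCK.antisymm
    (hP.subset_of_isConvexSubset hG h hdiv hdn hC hCK hCsub.isConvexSubset)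

theorem eq_univ_iff (hP : IsQuadraticPartition L K e) : K = univ ↔ n = 1 := by
  constructor
  · rintro rfl
    have himg : ∀ i, quad (e i) '' univ = univ := fun i =>
      Set.eq_univ_of_forall fun x => ⟨_, trivial, quad_quad_neg _ x⟩
    have hs : ∀ i k : Fin n, i = k := fun i k => by
      by_contra hik
      have h1 := hP.disjoint hik
      simp only [himg] at h1
      exact Set.disjoint_left.1 h1 (mem_univ 0) (mem_univ 0)
    have h1 : n ≤ 1 := by
      by_contra! hn
      exact absurd (congrArg Fin.val (hs ⟨0, hP.pos⟩ ⟨1, hn⟩)) zero_ne_one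
    exact le_antisymm h1 hP.pos
  · rintro rfl
    refine Set.eq_univ_of_forall fun x => ?_
    obtain ⟨i, k, hk, hkx⟩ := hP.cover (quad (e 0) x)
    rw [Subsingleton.elim i 0] at hkx
    rwa [← quad_neg_quad (e 0) x, ← hkx, quad_neg_quad]

end IsQuadraticPartition

end Component

section Rank

variable {L : FirstOrder.Language.{u, v}} {B : Type w} [L.Structure B]

theorem rankGeneric_iff_setRankGE {N : Type (max u v w)} [L.Structure N] (j : B ↪ₑ[L] N)
    {α : Ordinal.{max u v w}} {D : Set B} :
    RankGeneric.{u, v, w} j α D ↔ SetRankGE.{u, v, w} L α D := by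
  constructor
  · rintro ⟨φ, rfl, hφ⟩
    exact (setRankGE_solutionSet_iff j).2 hφ
  · intro hD
    obtain ⟨φ, rfl, -⟩ := id hD
    exact rankGeneric_solutionSet_iff.2 ((setRankGE_solutionSet_iff j).1 hD)

/-- The K-loop has a quadratic partition whose number of parts is its Morley degree. -/
theorem exists_isQuadraticPartition [KLoop B] (h : DefinableLaw L B)
    (hs : OmegaStable.{u, v, w} L B) (hdiv : UniquelyTwoDivisible B) :
    ∃ (α : Ordinal.{max u v w}) (d : ℕ) (K : Set B) (n : ℕ) (e : Fin n → B),
      ¬SetRankGE.{u, v, w} L (Order.succ α) (univ : Set B) ∧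
      IsLargeness L (fun D : Set B => SetRankGE.{u, v, w} L α D) d ∧
      IsQuadraticPartition L K e ∧ d ≤ n ∧ morleyDegree.{u, v, w} L (univ : Set B) = d := by
  have : Nonempty B := ⟨0⟩
  obtain ⟨α, d, hα, hα', hmax, I, U, ψ, hψ, hψα⟩ := hs.exists_rank_degree
  let M := Ultrapower U B
  let j : B ↪ₑ[L] M := diag L U B
  have hM : M ⊨ L.completeTheory B :=
    model_of_elementaryEmbedding j (inferInstanceAs (B ⊨ L.completeTheory B))
  have htop : ∀ {N : Type (max u v w)} [L.Structure N] (j : B ↪ₑ[L] N) {β}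
      {ψ : L.Formula (N ⊕ Unit)}, FormulaRankGE.{u, v, w} L β N ψ →
      SetRankGE.{u, v, w} L β (univ : Set B) := by
    intro N _ j β ψ hψ
    rw [← solutionSet_top (L := L), setRankGE_solutionSet_iff j]
    refine hψ.mono ?_
    rw [solutionSet_transport_top]
    exact Set.subset_univ _
  have hMtop : FormulaRankGE.{u, v, w} L α M ⊤ := by
    rw [← solutionSet_top (L := L), setRankGE_solutionSet_iff j] at hα
    refine hα.mono ?_
    rw [solutionSet_top]
    exact Set.subset_univ _
  have hGM : IsGenericity L (RankGeneric.{u, v, w} (ElementaryEmbedding.refl L M) α) d :=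
    { isLargeness_rankGeneric (ElementaryEmbedding.refl L M) hMtop fun n ψ => hmax M j n ψ with
      exists_family := ⟨fun i => solutionSet (ψ i),
        fun i => rankGeneric_solutionSet_iff.2 ((hψα i).transport α _), hψ⟩
      not_order := fun R hR a b => hs.not_order hM hR a b }
  obtain ⟨K₁, n, e₁, hP₁, hdn⟩ :=
    exists_isQuadraticPartition_of_isGenericity hGM h.ultrapower hdiv.ultrapower
  obtain ⟨K, e, hP⟩ := hP₁.of_ultrapower
  have hGB : IsLargeness L (fun D : Set B => SetRankGE.{u, v, w} L α D) d := by
    have h1 := isLargeness_rankGeneric j hMtop fun n ψ => hmax M j n ψ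
    have h2 : RankGeneric.{u, v, w} j α = fun D : Set B => SetRankGE.{u, v, w} L α D :=
      funext fun D => propext (rankGeneric_iff_setRankGE j)
    rwa [h2] at h1
  refine ⟨α, d, K, n, e, hα', hGB, hP, hdn, ?_⟩
  have hrank : morleyRank.{u, v, w} L (univ : Set B) =
      ((α : WithTop Ordinal.{max u v w}) : WithBot _) := morleyRank_eq_of_setRankGE hα hα'
  have hrankN : ∀ {N : Type (max u v w)} [L.Structure N] (j : B ↪ₑ[L] N)
      (ψ : L.Formula (N ⊕ Unit)), morleyRank.{u, v, max u v w} L (solutionSet ψ) =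
        morleyRank.{u, v, w} L (univ : Set B) ↔ FormulaRankGE.{u, v, w} L α N ψ := by
    intro N _ j ψ
    rw [hrank, morleyRank_eq_coe_iff.{u, v, max u v w} (definable₁_solutionSet ψ),
      setRankGE_self_iff.{u, v, w}]
    rw [setRankGE_self_iff.{u, v, w}]
    exact fun hn => hα' (htop j hn)
  refine le_antisymm (sSup_le ?_) (le_sSup ?_)
  · rintro _ ⟨m, rfl, φ, -, N, _, j, ψ, -, hdisj, hr⟩
    exact Nat.cast_le.2 (hmax N j m ψ hdisj fun i => (hrankN j _).1 (hr i))
  · refine ⟨d, rfl, ⊤, solutionSet_top, M, _, j, ψ, fun i => ?_, hψ,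
      fun i => (hrankN j _).2 (hψα i)⟩
    rw [solutionSet_transport_top]
    exact Set.subset_univ _

end Rank

end KLoop

theorem mainTheorem6 (L : FirstOrder.Language.{u, v}) (B : Type w) [L.Structure B] [KLoop B]
    (hlaw : KLoop.DefinableLaw L B) (hstable : ModelTheory.OmegaStable L B)
    (hdiv : KLoop.UniquelyTwoDivisible B) :
    [KLoop.BConnected L (Set.univ : Set B),
      KLoop.Connected L (Set.univ : Set B),
      ModelTheory.morleyDegree L (Set.univ : Set B) = 1].TFAE ∧
    ∃! C : Set B, KLoop.IsConnectedComponent L C := by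
  obtain ⟨α, d, K, n, e, hα, hG, hP, hdn, hdeg⟩ :=
    KLoop.exists_isQuadraticPartition hlaw hstable hdiv
  have hnd : d = n := hdn.antisymm (hP.card_le hG hlaw)
  have hrank : ∀ D : Set B, (Set.univ : Set B).Definable₁ L D →
      (ModelTheory.morleyRank.{u, v, w} L D = ModelTheory.morleyRank.{u, v, w} L Set.univ ↔
        ModelTheory.SetRankGE.{u, v, w} L α D) := fun D hD => by
    rw [ModelTheory.morleyRank_eq_of_setRankGE hG.gen_univ hα]
    exact ModelTheory.morleyRank_eq_coe_iff hD fun h =>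
      hα (h.mono ModelTheory.definable₁_univ (Set.subset_univ D))
  have hKgen := hP.gen hG hlaw
  have hKrank := (hrank K hP.definable).2 hKgen
  have hKconn : KLoop.Connected L K := by
    rintro ⟨D, hDK, hD, hconv, hr⟩
    refine hDK.2 (hP.subset_of_isConvexSubset hG hlaw hdiv hdn ?_ hDK.1 hconv)
    exact (hrank D hD).1 (hr.trans hKrank)
  refine ⟨?_, K, ⟨hP.definable, hP.isSubloop, hKrank, hKconn⟩, ?_⟩
  · rw [hdeg, hnd, Nat.cast_eq_one, ← hP.eq_univ_iff]
    tfae_have 1 → 3 := fun hB => by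
      by_contra hK
      exact hB ⟨K, Set.ssubset_univ_iff.2 hK, hP.definable, hP.isSubloop, hKrank⟩
    tfae_have 3 → 2 := fun hK => hK ▸ hKconn
    tfae_have 2 → 1 := by
      rintro hB ⟨D, hD, hdef, hsub, hr⟩
      exact hB ⟨D, hD, hdef, hsub.isConvexSubset, hr⟩
    tfae_finish
  · rintro C ⟨hCdef, hCsub, hCrank, hCconn⟩
    refine hP.eq_of_forall_isConvexSubset hG hlaw hdiv hdn ((hrank C hCdef).1 hCrank) hCsub ?_
    intro D hDC hD hconv
    by_contra hCD
    have hDdef := hG.definable D hD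
    exact hCconn ⟨D, ⟨hDC, hCD⟩, hDdef, hconv, ((hrank D hDdef).2 hD).trans hCrank.symm⟩
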